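/- Let $E$ be a real Banach space with dual $E^*$ which is uniformly smooth (the limit $\lim_{t\to0}(\|x+ty\|-\|x\|)/t$ exists uniformly for $x,y$ in the unit sphere) and 2-uniformly convex (for some $c>0$, its modulus of convexity satisfies $\delta_E(\epsilon)\ge c\,\epsilon^2$ for all $\epsilon\in[0,2]$). Let $J:E\to E^*$ be the normalized duality mapping, $\langle Jx,x\rangle=\|Jx\|^2=\|x\|^2$, and assume that $J$ is weakly sequentially continuous: $x_n\rightharpoonup x$ in $E$ implies $Jx_n\rightharpoonup^* Jx$ in $E^*$. Let $B:E\to 2^{E^*}$ be maximal monotone, let $A:E\to E^*$ be monotone and Lipschitz continuous with constant $L>0$, and suppose that $(A+B)^{-1}(0)=\{x\in E: 0\in Ax+Bx\}$ is nonempty. Let $\mu$ be the 2-uniform convexity constant of $E$, i.e. the least $\mu\ge1$ such that $$\tfrac12\big(\|x+y\|^2+\|x-y\|^2\big)\ \ge\ \|x\|^2+\mu^{-1}\|y\|^2\qquad\text{for all }x,y\in E,$$ and let $\kappa$ be the 2-uniform smoothness constant of $E^*$, i.e. the least $\kappa\ge 1/\sqrt2$ such that $$\|f+g\|^2\ \le\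 \|f\|^2+2\langle g,J_*f\rangle+2\kappa^2\|g\|^2\qquad\text{for all }f,g\in E^*,$$ where $J_*$ is the normalized duality mapping of $E^*$. (The bound $\kappa\ge1/\sqrt2$ is automatic unless $E=\{0\}$.) Let the step sizes satisfy $$0<a\le\lambda_n\le b<\frac{1}{\sqrt{2\mu}\,\kappa L}\qquad(n\ge1).$$ For $r>0$ let $J_r^B=(J+rB)^{-1}J$ be the resolvent of $B$, and let $(x_n)_{n\ge1}$, $(y_n)_{n\ge1}$ be generated from an arbitrary $x_1\in E$ by $$y_n=J_{\lambda_n}^B\,J^{-1}(Jx_n-\lambda_nAx_n),\qquad x_{n+1}=J^{-1}\big(Jy_n-\lambda_n(Ay_n-Ax_n)\big).$$ Then $(x_n)$ converges weakly to some $z\in(A+B)^{-1}(0)$. Moreover, for every $n$ there is a unique generalized projection $\Pi_{(A+B)^{-1}(0)}(x_n)$, i.e. a unique minimizer of $u\mapsto\phi(u,x_n)=\|u\|^2-2\langle u,Jx_n\rangle+\|x_n\|^2$ over $(A+B)^{-1}(0)$, and $$z=\lim_{n\to\infty}\Pi_{(A+B)^{-1}(0)}(x_n)$$ in norm. -/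

import Mathlib

open Filter Topology
open scoped NNReal

noncomputable section

namespace BanachTseng

/-! Geometry of normed spaces -/

section Geometry

variable (E : Type*) [NormedAddCommGroup E] [NormedSpace ℝ E]

/-- The modulus of convexity `δ_E(ε)`, the infimum of `1 - ‖(x + y) / 2‖` over all `x, y` in the
closed unit ball with `‖x - y‖ ≥ ε`; as usual the infimum over the empty set is `+∞`. -/
def modulusOfConvexity (ε : ℝ) : EReal :=
  ⨅ (x : E) (y : E) (_ : ‖x‖ ≤ 1 ∧ ‖y‖ ≤ 1 ∧ ε ≤ ‖x - y‖),
    ((1 - ‖(1 / 2 : ℝ) • (x + y)‖ : ℝ) : EReal)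

/-- `E` is 2-uniformly convex: `δ_E(ε) ≥ c ε²` on `[0, 2]` for some `c > 0`. -/
def IsTwoUniformlyConvex : Prop :=
  ∃ c : ℝ, 0 < c ∧ ∀ ε ∈ Set.Icc (0 : ℝ) 2, ((c * ε ^ 2 : ℝ) : EReal) ≤ modulusOfConvexity E ε

/-- `E` is uniformly smooth: the limit of `(‖x + t y‖ - ‖x‖) / t` as `t → 0` exists uniformly for
`x, y` in the unit sphere. -/
def IsUniformlySmooth : Prop :=
  ∃ g : E × E → ℝ,
    TendstoUniformlyOn (fun (t : ℝ) (p : E × E) => (‖p.1 + t • p.2‖ - ‖p.1‖) / t) g (𝓝[≠] 0)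
      (Metric.sphere (0 : E) 1 ×ˢ Metric.sphere (0 : E) 1)

/-- The 2-uniform convexity constant `μ` of `E`: the least `m ≥ 1` with
`(‖x + y‖² + ‖x - y‖²) / 2 ≥ ‖x‖² + m⁻¹ ‖y‖²` for all `x, y`. -/
def twoUniformConvexityConst : ℝ :=
  sInf {m : ℝ | 1 ≤ m ∧
    ∀ x y : E, ‖x‖ ^ 2 + m⁻¹ * ‖y‖ ^ 2 ≤ (‖x + y‖ ^ 2 + ‖x - y‖ ^ 2) / 2}

variable {E}

/-- The (set-valued) normalized duality mapping,
`x ↦ {f ∈ E* | ⟨f, x⟩ = ‖f‖² = ‖x‖²}`. -/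
def dualitySet (x : E) : Set (StrongDual ℝ E) :=
  {f | f x = ‖f‖ ^ 2 ∧ ‖f‖ ^ 2 = ‖x‖ ^ 2}

theorem dualitySet_nonempty (x : E) : (dualitySet x).Nonempty := by
  by_cases hx : x = 0
  · exact ⟨0, by simp [dualitySet, hx]⟩
  · obtain ⟨g, hg, hgx⟩ := exists_dual_vector ℝ x (norm_ne_zero_iff.mpr hx)
    refine ⟨‖x‖ • g, ?_, ?_⟩
    · simp [norm_smul, hg, hgx, sq]
    · simp [norm_smul, hg]

/-- The normalized duality mapping as a function `J : E → E*`. When `E` is smooth, `dualitySet x`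
is a singleton and `J x` is its only element. -/
def J (x : E) : StrongDual ℝ E := (dualitySet_nonempty x).choose

theorem J_mem (x : E) : J x ∈ dualitySet x := (dualitySet_nonempty x).choose_spec

variable (E)

/-- The 2-uniform smoothness constant `κ` of `E`: the least `k` with
`‖x + y‖² ≤ ‖x‖² + 2 ⟨y, J x⟩ + 2 k² ‖y‖²` for all `x, y`.
In a nonzero space `x = 0` forces `k ≥ 1 / √2` for any such positive `k`; that bound is written out
so that the zero space, like every other Hilbert space, has `κ = 1 / √2`. -/
def twoUniformSmoothnessConst : ℝ :=
  sInf {k : ℝ | 1 / √2 ≤ k ∧ ∀ x y : E, ∀ j ∈ dualitySet x,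
    ‖x + y‖ ^ 2 ≤ ‖x‖ ^ 2 + 2 * j y + 2 * k ^ 2 * ‖y‖ ^ 2}

end Geometry

section Operators

variable {E : Type*} [NormedAddCommGroup E] [NormedSpace ℝ E]

/-- Weak convergence `x_n ⇀ z` in `E`. -/
def WeaklyConverges (x : ℕ → E) (z : E) : Prop :=
  Tendsto (fun n => toWeakSpace ℝ E (x n)) atTop (𝓝 (toWeakSpace ℝ E z))

/-- Weak-* convergence `f_n ⇀* g` in `E*`. -/
def WeakStarConverges (f : ℕ → StrongDual ℝ E) (g : StrongDual ℝ E) : Prop :=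
  Tendsto (fun n => StrongDual.toWeakDual (f n)) atTop (𝓝 (StrongDual.toWeakDual g))

variable (E) in
/-- `J` is weakly sequentially continuous: `x_n ⇀ x` implies `J x_n ⇀* J x`. -/
def DualityWeaklySeqContinuous : Prop :=
  ∀ (x : ℕ → E) (z : E), WeaklyConverges x z → WeakStarConverges (fun n => J (x n)) (J z)

/-- A single-valued operator `A : E → E*` is monotone. -/
def IsMonotoneMap (A : E → StrongDual ℝ E) : Prop :=
  ∀ x y : E, 0 ≤ (A x - A y) (x - y)

/-- A multi-valued operator `B : E → 2^{E*}` is monotone. -/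
def IsMonotoneOperator (B : E → Set (StrongDual ℝ E)) : Prop :=
  ∀ x y : E, ∀ u ∈ B x, ∀ v ∈ B y, 0 ≤ (u - v) (x - y)

/-- A monotone operator is maximal if its graph is not properly contained in the graph of another
monotone operator. -/
def IsMaximalMonotone (B : E → Set (StrongDual ℝ E)) : Prop :=
  IsMonotoneOperator B ∧
    ∀ S : E → Set (StrongDual ℝ E), IsMonotoneOperator S → (∀ x, B x ⊆ S x) → B = S

/-- The multi-valued sum `(A + B) x = {A x + v | v ∈ B x}`. -/
def sumOperator (A : E → StrongDual ℝ E) (B : E → Set (StrongDual ℝ E)) (x : E) :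
    Set (StrongDual ℝ E) :=
  (fun v => A x + v) '' B x

/-- The zero set `T⁻¹(0) = {x | 0 ∈ T x}` of a multi-valued operator. -/
def zeroSet (T : E → Set (StrongDual ℝ E)) : Set E := {x | 0 ∈ T x}

/-- `z` is a value at `w` of the resolvent `J_r^B = (J + r B)⁻¹ J`, that is, `J w ∈ J z + r B z`. -/
def IsResolvent (B : E → Set (StrongDual ℝ E)) (r : ℝ) (w z : E) : Prop :=
  ∃ v ∈ B z, J w = J z + r • v

/-- The sequences `x_n`, `y_n` (numbered from `0`) are generated by the Tseng-type iteration
`y_n = J_{λ_n}^B (J⁻¹ (J x_n - λ_n A x_n))`, `x_{n+1} = J⁻¹ (J y_n - λ_n (A y_n - A x_n))`, where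
`w = J⁻¹ f` is expressed as `J w = f`. -/
def IsTsengSequence (A : E → StrongDual ℝ E) (B : E → Set (StrongDual ℝ E)) (lam : ℕ → ℝ)
    (x y : ℕ → E) : Prop :=
  ∀ n, (∃ w : E, J w = J (x n) - lam n • A (x n) ∧ IsResolvent B (lam n) w (y n)) ∧
    J (x (n + 1)) = J (y n) - lam n • (A (y n) - A (x n))

/-- The functional `φ(x, y) = ‖x‖² - 2 ⟨x, J y⟩ + ‖y‖²`. -/
def phi (x y : E) : ℝ := ‖x‖ ^ 2 - 2 * J y x + ‖y‖ ^ 2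

/-- `p` is a generalized projection `Π_C x`: a minimizer of `φ(·, x)` over `C`. -/
def IsGeneralizedProjection (C : Set E) (x p : E) : Prop :=
  p ∈ C ∧ ∀ q ∈ C, phi p x ≤ phi q x

end Operators

end BanachTseng

end

/-! The argument is Lyapunov (Fejér) descent measured by `phi`. For a zero `p` of `A + B`, the
smoothness inequality of `E*` at `J y`, with increment `-λ(A y - A x)`, and monotonicity of `A` and
`B` give `φ(p, x') ≤ φ(p, x) - φ(y, x) + 2κ²λ²L²‖y - x‖²` (`phi_tseng_step_le`). Uniform convexity
gives `μ⁻¹‖y - x‖² ≤ φ(y, x)` (`mul_norm_sub_sq_le_phi`), and the step-size bound says exactly that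
the gain beats the error. So `φ(p, x_n)` decreases, `(x_n)` is bounded and `y_n - x_n → 0`. Uniform
continuity of `J` on bounded sets then yields elements of `(A + B) y_n` tending to `0` in norm.

Weak cluster points are zeros of `A + B` by Minty's characterization `mem_zeroSet_iff_forall`, which
rests on surjectivity of `A + B + J(· - p)`: Rockafellar's theorem for `B + J`, obtained by
separating the Fitzpatrick function from a quadratic, followed by a continuation argument that adds
`A`. The same characterization makes the zero set closed and convex.

The projections `u_n` of `x_n` form a Cauchy sequence by Fejér monotonicity
(`exists_tendsto_projection`). Weak continuity of `J` lets one pass to the limit in `φ(u_n, x_n) ≤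
φ(z, x_n)` along a subsequence with weak limit `z`, forcing `z = lim u_n` (`eq_of_weak_cluster`).
The cluster point is thus unique and the whole sequence converges weakly. -/

namespace BanachTseng

/-! ### Quadratic inequalities from 2-uniform convexity -/

section Geometry

variable {E : Type*} [NormedAddCommGroup E] [NormedSpace ℝ E]

/-- The modulus is effective only for vectors of comparable norm. If the norms differ by at least
half the distance, convexity of the square already gives the gain; otherwise `v` can be moved
radially to the sphere at the cost of half the distance. -/
theorem norm_midpoint_sq_add_le {c : ℝ} (hc : 0 < c)
    (h : ∀ u v : E, ‖u‖ ≤ 1 → ‖v‖ ≤ 1 → c * ‖u - v‖ ^ 2 ≤ 1 - ‖(1 / 2 : ℝ) • (u + v)‖)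
    {u v : E} (hu : ‖u‖ = 1) (hv : ‖v‖ ≤ 1) :
    ‖(1 / 2 : ℝ) • (u + v)‖ ^ 2 + min (1 / 16) (c / 24) * ‖u - v‖ ^ 2 ≤
      (1 + ‖v‖ ^ 2) / 2 := by
  set s := ‖v‖ with hs
  set D := ‖u - v‖ with hD
  set N := ‖(1 / 2 : ℝ) • (u + v)‖ with hN
  have hs0 : 0 ≤ s := norm_nonneg _
  have hD0 : 0 ≤ D := norm_nonneg _
  have hN0 : 0 ≤ N := norm_nonneg _
  have hDs : D ≤ 1 + s := by simpa [hu] using norm_sub_le u v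
  have hNs : N ≤ (1 + s) / 2 := by
    have := norm_add_le u v
    rw [hu] at this
    rw [hN, norm_smul, Real.norm_of_nonneg (by norm_num)]
    linarith
  -- In the first case `(1 + s²)/2 - ((1 + s)/2)² = (1 - s)²/4 ≥ D²/16`.
  by_cases hcase : D / 2 ≤ 1 - s
  · have h1 : min (1 / 16) (c / 24) * D ^ 2 ≤ 1 / 16 * D ^ 2 := by
      gcongr; exact min_le_left _ _
    nlinarith
  · push Not at hcase
    have hs3 : 1 / 3 < s := by linarith
    have hspos : 0 < s := by linarith
    set v' : E := s⁻¹ • v with hv'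
    have hv'n : ‖v'‖ = 1 := by
      rw [hv', norm_smul, norm_inv, Real.norm_of_nonneg hs0, ← hs]; field_simp
    have hsv : s • v' = v := by rw [hv', smul_smul, mul_inv_cancel₀ hspos.ne', one_smul]
    have hD' : D / 2 ≤ ‖u - v'‖ := by
      have h1 : D ≤ ‖u - v'‖ + ‖v' - v‖ := norm_sub_le_norm_sub_add_norm_sub _ _ _
      have h2 : v' - v = (1 - s) • v' := by rw [sub_smul, hsv, one_smul]
      rw [h2, norm_smul, hv'n, Real.norm_of_nonneg (by linarith)] at h1
      linarith
    have hm := h u v' hu.le hv'n.le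
    have hNle : N ≤ s * ‖(1 / 2 : ℝ) • (u + v')‖ + (1 - s) / 2 := by
      have h1 : (1 / 2 : ℝ) • (u + v) = s • ((1 / 2 : ℝ) • (u + v')) + ((1 - s) / 2) • u := by
        rw [← hsv]; module
      rw [hN, h1]
      refine (norm_add_le _ _).trans ?_
      rw [norm_smul s, norm_smul ((1 - s) / 2), hu, Real.norm_of_nonneg hs0,
        Real.norm_of_nonneg (by linarith)]
      linarith
    set e := s * (c * ‖u - v'‖ ^ 2) with he
    have hNe : N ≤ (1 + s) / 2 - e := by nlinarith
    -- The factor `1/12` is `1/3` from `s > 1/3` times `1/4` from `‖u - v'‖ ≥ D/2`.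
    have hee : c / 12 * D ^ 2 ≤ e := by
      have h1 : (D / 2) ^ 2 ≤ ‖u - v'‖ ^ 2 := by gcongr
      have h2 : c * (D / 2) ^ 2 ≤ c * ‖u - v'‖ ^ 2 := by gcongr
      have h3 : 0 ≤ c * ‖u - v'‖ ^ 2 := by positivity
      nlinarith
    have he0 : 0 ≤ e := by positivity
    have hNN : N ^ 2 ≤ ((1 + s) / 2) * ((1 + s) / 2 - e) := by
      rw [sq]; exact mul_le_mul hNs hNe hN0 (by linarith)
    have h1 : min (1 / 16) (c / 24) * D ^ 2 ≤ c / 24 * D ^ 2 := by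
      gcongr; exact min_le_right _ _
    nlinarith

theorem IsTwoUniformlyConvex.exists_const (h : IsTwoUniformlyConvex E) :
    ∃ m : ℝ, 1 ≤ m ∧
      ∀ x y : E, ‖x‖ ^ 2 + m⁻¹ * ‖y‖ ^ 2 ≤ (‖x + y‖ ^ 2 + ‖x - y‖ ^ 2) / 2 := by
  obtain ⟨c, hc, hmod⟩ := h
  have hmod' : ∀ u v : E, ‖u‖ ≤ 1 → ‖v‖ ≤ 1 →
      c * ‖u - v‖ ^ 2 ≤ 1 - ‖(1 / 2 : ℝ) • (u + v)‖ := by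
    intro u v hu hv
    have h2 : ‖u - v‖ ≤ 2 := (norm_sub_le _ _).trans (by linarith)
    have h3 := hmod ‖u - v‖ ⟨norm_nonneg _, h2⟩
    rw [modulusOfConvexity] at h3
    have h4 := h3.trans (iInf_le _ u)
    have h5 := h4.trans (iInf_le _ v)
    have h6 := h5.trans (iInf_le _ ⟨hu, hv, le_rfl⟩)
    exact_mod_cast h6
  set k := min (1 / 16) (c / 24) with hk
  have hk0 : 0 < k := by positivity
  have key : ∀ u v : E, ‖v‖ ≤ ‖u‖ →
      ‖(1 / 2 : ℝ) • (u + v)‖ ^ 2 + k * ‖u - v‖ ^ 2 ≤ (‖u‖ ^ 2 + ‖v‖ ^ 2) / 2 := by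
    intro u v huv
    rcases eq_or_ne u 0 with rfl | hu
    · have : v = 0 := by simpa using huv
      simp [this]
    have hr : 0 < ‖u‖ := norm_pos_iff.2 hu
    have h1 := norm_midpoint_sq_add_le hc hmod' (u := ‖u‖⁻¹ • u) (v := ‖u‖⁻¹ • v)
      (by rw [norm_smul, norm_inv, norm_norm]; field_simp)
      (by rw [norm_smul, norm_inv, norm_norm]; rw [inv_mul_le_iff₀ hr]; simpa using huv)
    rw [← smul_add, ← smul_sub, smul_comm, norm_smul ‖u‖⁻¹, norm_smul ‖u‖⁻¹, norm_smul ‖u‖⁻¹,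
      norm_inv, norm_norm, ← hk] at h1
    have h2 := mul_le_mul_of_nonneg_left h1 (sq_nonneg ‖u‖)
    field_simp at h2 ⊢
    linarith
  -- `x` is the midpoint of `x + y` and `x - y`, whose difference `2y` turns `k` into `4k`.
  refine ⟨max 1 ((4 * k)⁻¹), le_max_left _ _, fun x y => ?_⟩
  have hle : (max 1 ((4 * k)⁻¹))⁻¹ ≤ 4 * k := by
    rw [inv_le_comm₀ (by positivity) (by positivity)]; exact le_max_right _ _
  have h1 : ‖x‖ ^ 2 + 4 * k * ‖y‖ ^ 2 ≤ (‖x + y‖ ^ 2 + ‖x - y‖ ^ 2) / 2 := by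
    have ha : (1 / 2 : ℝ) • ((x + y) + (x - y)) = x := by module
    have hb : (1 / 2 : ℝ) • ((x - y) + (x + y)) = x := by module
    have hc : (x + y) - (x - y) = (2 : ℝ) • y := by module
    have hd : (x - y) - (x + y) = (-2 : ℝ) • y := by module
    rcases le_total ‖x - y‖ ‖x + y‖ with h | h
    · have := key _ _ h
      rw [ha, hc, norm_smul] at this
      norm_num at this; nlinarith
    · have := key _ _ h
      rw [hb, hd, norm_smul] at this
      norm_num at this; nlinarith
  have := mul_le_mul_of_nonneg_right hle (sq_nonneg ‖y‖)
  linarith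

/-- The infimum is attained: after multiplication by `m > 0` the defining conditions are closed, and
`exists_const` supplies an admissible constant. -/
theorem twoUniformConvexityConst_spec (h : IsTwoUniformlyConvex E) :
    1 ≤ twoUniformConvexityConst E ∧ ∀ x y : E,
      ‖x‖ ^ 2 + (twoUniformConvexityConst E)⁻¹ * ‖y‖ ^ 2 ≤ (‖x + y‖ ^ 2 + ‖x - y‖ ^ 2) / 2 := by
  set S := {m : ℝ | 1 ≤ m ∧
    ∀ x y : E, ‖x‖ ^ 2 + m⁻¹ * ‖y‖ ^ 2 ≤ (‖x + y‖ ^ 2 + ‖x - y‖ ^ 2) / 2} with hS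
  have hS' : S = Set.Ici 1 ∩
      ⋂ (x : E) (y : E), {m : ℝ | m * ‖x‖ ^ 2 + ‖y‖ ^ 2 ≤
        m * ((‖x + y‖ ^ 2 + ‖x - y‖ ^ 2) / 2)} := by
    ext m
    simp only [hS, Set.mem_ofPred_eq, Set.mem_inter_iff, Set.mem_Ici, Set.mem_iInter]
    refine and_congr_right fun hm => forall_congr' fun x => forall_congr' fun y => ?_
    have hm0 : 0 < m := by linarith
    rw [← mul_le_mul_iff_right₀ hm0, mul_add, ← mul_assoc, mul_inv_cancel₀ hm0.ne', one_mul]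
  have hcl : IsClosed S := by
    rw [hS']
    refine isClosed_Ici.inter (isClosed_iInter fun x => isClosed_iInter fun y => ?_)
    exact isClosed_le (by fun_prop) (by fun_prop)
  exact hcl.csInf_mem h.exists_const ⟨1, fun m hm => hm.1⟩

theorem dualitySet_norm {x : E} {f : StrongDual ℝ E} (hf : f ∈ dualitySet x) : ‖f‖ = ‖x‖ :=
  (sq_eq_sq₀ (norm_nonneg _) (norm_nonneg _)).1 hf.2

theorem dualitySet_apply_self {x : E} {f : StrongDual ℝ E} (hf : f ∈ dualitySet x) :
    f x = ‖x‖ ^ 2 := hf.1.trans hf.2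

theorem dualitySet_apply_le {x : E} {f : StrongDual ℝ E} (hf : f ∈ dualitySet x) (y : E) :
    2 * f y ≤ ‖x‖ ^ 2 + ‖y‖ ^ 2 := by
  have h := (le_abs_self _).trans (f.le_opNorm y)
  rw [dualitySet_norm hf] at h
  nlinarith [sq_nonneg (‖x‖ - ‖y‖)]

theorem smul_mem_dualitySet {x : E} {f : StrongDual ℝ E} (hf : f ∈ dualitySet x) (r : ℝ) :
    r • f ∈ dualitySet (r • x) := by
  have h1 := dualitySet_apply_self hf
  have h2 := dualitySet_norm hf
  constructor
  · simp only [smul_apply, map_smul, smul_eq_mul, norm_smul, h1, h2, mul_pow,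
      Real.norm_eq_abs, sq_abs]; ring
  · rw [norm_smul, norm_smul, h2]

theorem inclusion_mem_dualitySet {x : E} {f : StrongDual ℝ E} (hf : f ∈ dualitySet x) :
    NormedSpace.inclusionInDoubleDual ℝ E x ∈ dualitySet f := by
  have h : ‖NormedSpace.inclusionInDoubleDual ℝ E x‖ = ‖x‖ :=
    (NormedSpace.inclusionInDoubleDualLi ℝ (E := E)).norm_map x
  refine ⟨?_, ?_⟩
  · rw [h, NormedSpace.dual_def, dualitySet_apply_self hf]
  · rw [h, dualitySet_norm hf]

/-- The one-sided quadratic bound given by 2-uniform convexity. -/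
theorem dualitySet_add_sq_le {m : ℝ}
    (hU : ∀ x y : E, ‖x‖ ^ 2 + m * ‖y‖ ^ 2 ≤ (‖x + y‖ ^ 2 + ‖x - y‖ ^ 2) / 2)
    {x : E} {f : StrongDual ℝ E} (hf : f ∈ dualitySet x) (h : E) :
    ‖x‖ ^ 2 + 2 * f h + m * ‖h‖ ^ 2 ≤ ‖x + h‖ ^ 2 := by
  -- The case `k = 0` is the subgradient inequality. Applying convexity at the midpoint `x + h/2`
  -- and the induction hypothesis to `h/2` halves the missing fraction of `m`.
  have key : ∀ k : ℕ, ∀ h : E,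
      ‖x‖ ^ 2 + 2 * f h + m * (1 - (1 / 2) ^ k) * ‖h‖ ^ 2 ≤ ‖x + h‖ ^ 2 := by
    intro k
    induction k with
    | zero =>
      intro h
      have h1 := dualitySet_apply_le hf (x + h)
      rw [map_add, dualitySet_apply_self hf] at h1
      simp; linarith
    | succ k ih =>
      intro h
      have h1 := ih ((1 / 2 : ℝ) • h)
      have h2 := hU (x + (1 / 2 : ℝ) • h) ((1 / 2 : ℝ) • h)
      have h3 : x + (1 / 2 : ℝ) • h + (1 / 2 : ℝ) • h = x + h := by module
      have h4 : x + (1 / 2 : ℝ) • h - (1 / 2 : ℝ) • h = x := by module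
      have h5 : ‖(1 / 2 : ℝ) • h‖ ^ 2 = ‖h‖ ^ 2 / 4 := by
        rw [norm_smul, Real.norm_of_nonneg (by norm_num)]; ring
      rw [h3, h4, h5] at h2
      rw [map_smul, smul_eq_mul, h5] at h1
      rw [pow_succ (1 / 2 : ℝ)]
      linarith
  have hlim : Tendsto (fun k : ℕ => ‖x‖ ^ 2 + 2 * f h + m * (1 - (1 / 2 : ℝ) ^ k) * ‖h‖ ^ 2)
      atTop (𝓝 (‖x‖ ^ 2 + 2 * f h + m * (1 - 0) * ‖h‖ ^ 2)) :=
    (((tendsto_pow_atTop_nhds_zero_of_lt_one (by norm_num) (by norm_num)).const_sub 1).const_mul m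
      |>.mul_const _).const_add _
  simpa using le_of_tendsto' hlim fun k => key k h

theorem mul_norm_sub_sq_le_phi {m : ℝ}
    (hU : ∀ x y : E, ‖x‖ ^ 2 + m * ‖y‖ ^ 2 ≤ (‖x + y‖ ^ 2 + ‖x - y‖ ^ 2) / 2) (y x : E) :
    m * ‖y - x‖ ^ 2 ≤ phi y x := by
  have h := dualitySet_add_sq_le hU (J_mem x) (y - x)
  rw [add_sub_cancel, map_sub, dualitySet_apply_self (J_mem x)] at h
  rw [phi]; linarith

theorem J_norm (x : E) : ‖J x‖ = ‖x‖ := dualitySet_norm (J_mem x)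

theorem J_self (x : E) : J x x = ‖x‖ ^ 2 := dualitySet_apply_self (J_mem x)

/-- The duality map is strongly monotone in a 2-uniformly convex space. -/
theorem J_strongly_monotone {m : ℝ}
    (hU : ∀ x y : E, ‖x‖ ^ 2 + m * ‖y‖ ^ 2 ≤ (‖x + y‖ ^ 2 + ‖x - y‖ ^ 2) / 2) (x y : E) :
    m * ‖x - y‖ ^ 2 ≤ (J x - J y) (x - y) := by
  have h1 := mul_norm_sub_sq_le_phi hU x y
  have h2 := mul_norm_sub_sq_le_phi hU y x
  rw [norm_sub_rev y x] at h2
  simp only [phi] at h1 h2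
  simp only [sub_apply, map_sub, J_self]
  linarith

end Geometry

/-! ### Uniform continuity of the duality map -/

section Smoothness

variable {E : Type*} [NormedAddCommGroup E] [NormedSpace ℝ E]

/-- The slope `f y` dominates the difference quotient at `-t`, and by uniformity the quotients at
`t` and `-t` differ by less than `ε`. -/
theorem IsUniformlySmooth.norm_add_smul_le (h : IsUniformlySmooth E) {ε : ℝ} (hε : 0 < ε) :
    ∃ t : ℝ, 0 < t ∧ ∀ x y : E, ‖x‖ = 1 → ‖y‖ = 1 → ∀ f ∈ dualitySet x,
      ‖x + t • y‖ ≤ 1 + t * f y + ε * t := by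
  obtain ⟨g, hg⟩ := h
  rw [Metric.tendstoUniformlyOn_iff] at hg
  have hev := hg (ε / 2) (by positivity)
  rw [eventually_nhdsWithin_iff, Metric.eventually_nhds_iff] at hev
  obtain ⟨δ, hδ, hev⟩ := hev
  refine ⟨δ / 2, by positivity, fun x y hx hy f hf => ?_⟩
  have hmem : (x, y) ∈ Metric.sphere (0 : E) 1 ×ˢ Metric.sphere (0 : E) 1 := by simp [hx, hy]
  have h1 := hev (y := δ / 2) (by rw [Real.dist_eq, sub_zero, abs_of_pos] <;> linarith)
    (by simp only [Set.mem_compl_iff, Set.mem_singleton_iff]; positivity) _ hmem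
  have h2 := hev (y := -(δ / 2)) (by rw [Real.dist_eq, sub_zero, abs_neg, abs_of_pos] <;> linarith)
    (by simp only [Set.mem_compl_iff, Set.mem_singleton_iff]; linarith) _ hmem
  rw [Real.dist_eq, abs_lt] at h1 h2
  simp only [hx] at h1 h2
  set t := δ / 2 with ht
  have ht0 : 0 < t := by positivity
  have hfn : ‖f‖ = 1 := (dualitySet_norm hf).trans hx
  have h3 : f (x + (-t) • y) ≤ ‖x + (-t) • y‖ := by
    have := (le_abs_self _).trans (f.le_opNorm (x + (-t) • y))
    rwa [hfn, one_mul] at this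
  rw [map_add, dualitySet_apply_self hf, hx, map_smul, smul_eq_mul] at h3
  have h4 : (‖x + (-t) • y‖ - 1) / (-t) ≤ f y := by
    rw [div_neg, neg_le, le_div_iff₀ ht0]; linarith
  have h5 : (‖x + t • y‖ - 1) / t ≤ f y + ε := by linarith [h1.1, h2.2]
  rw [div_le_iff₀ ht0] at h5
  linarith

/-- Šmulian's argument: evaluate `f'` at `x + t y`. Here `f' x ≥ 1 - ‖x - x'‖`, while `‖x + t y‖` is
at most `1 + t f y` up to a small multiple of `t`. -/
theorem IsUniformlySmooth.norm_sub_le_of_sphere (h : IsUniformlySmooth E) {ε : ℝ} (hε : 0 < ε) :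
    ∃ δ : ℝ, 0 < δ ∧ ∀ x x' : E, ‖x‖ = 1 → ‖x'‖ = 1 → ‖x - x'‖ ≤ δ →
      ∀ f ∈ dualitySet x, ∀ f' ∈ dualitySet x', ‖f - f'‖ ≤ ε := by
  obtain ⟨t, ht, H⟩ := h.norm_add_smul_le (half_pos hε)
  refine ⟨ε / 2 * t, by positivity, fun x x' hx hx' hxx f hf f' hf' => ?_⟩
  have hf'n : ‖f'‖ = 1 := (dualitySet_norm hf').trans hx'
  have key : ∀ y : E, ‖y‖ = 1 → (f' - f) y ≤ ε := by
    intro y hy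
    have h1 := H x y hx hy f hf
    have h2 : ∀ z, f' z ≤ ‖z‖ := fun z => by
      simpa [hf'n] using (le_abs_self _).trans (f'.le_opNorm z)
    have h3 := h2 (x + t • y)
    have h4 := h2 (x' - x)
    rw [norm_sub_rev, map_sub, dualitySet_apply_self hf', hx'] at h4
    rw [map_add, map_smul, smul_eq_mul] at h3
    have h5 : t * ((f' - f) y) ≤ t * ε := by
      rw [sub_apply]; linarith
    exact le_of_mul_le_mul_left h5 ht
  refine ContinuousLinearMap.opNorm_le_of_unit_norm hε.le fun z hz => ?_
  rw [Real.norm_eq_abs, abs_le]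
  have h1 := key z hz
  have h2 := key (-z) (by rwa [norm_neg])
  rw [map_neg] at h2
  simp only [sub_apply] at *
  constructor <;> linarith

theorem IsUniformlySmooth.norm_sub_le_of_bounded (h : IsUniformlySmooth E) (R : ℝ) {ε : ℝ}
    (hε : 0 < ε) : ∃ δ : ℝ, 0 < δ ∧ ∀ x x' : E, ‖x‖ ≤ R → ‖x - x'‖ ≤ δ →
      ∀ f ∈ dualitySet x, ∀ f' ∈ dualitySet x', ‖f - f'‖ ≤ ε := by
  set R' := max R 1 with hR'
  have hR'1 : 1 ≤ R' := le_max_right _ _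
  obtain ⟨δ, hδ, H⟩ := h.norm_sub_le_of_sphere (ε := ε / (2 * R')) (by positivity)
  refine ⟨min (ε / 4) (δ * (ε / 8)), by positivity, fun x x' hx hxx f hf f' hf' => ?_⟩
  have hfn := dualitySet_norm hf
  have hfn' := dualitySet_norm hf'
  have hd1 : ‖x - x'‖ ≤ ε / 4 := hxx.trans (min_le_left _ _)
  have hd2 : ‖x - x'‖ ≤ δ * (ε / 8) := hxx.trans (min_le_right _ _)
  have habs := (abs_norm_sub_norm_le x x').trans hd1
  rw [abs_le] at habs
  -- Near the origin `‖f‖ + ‖f'‖ ≤ 2‖x‖ + ε/4 ≤ ε`. Away from it, normalizing costs a factor at most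
  -- `2/‖x‖`, which the choice of `δ * (ε / 8)` absorbs.
  by_cases hxs : ‖x‖ ≤ 3 * ε / 8
  · refine (norm_sub_le _ _).trans ?_
    rw [hfn, hfn']; linarith
  push Not at hxs
  have hx0 : 0 < ‖x‖ := by linarith
  have hx0' : 0 < ‖x'‖ := by linarith
  have h1 := H (‖x‖⁻¹ • x) (‖x'‖⁻¹ • x') (by rw [norm_smul, norm_inv, norm_norm]; field_simp)
    (by rw [norm_smul, norm_inv, norm_norm]; field_simp) ?_ _ (smul_mem_dualitySet hf _) _
    (smul_mem_dualitySet hf' _)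
  · have h2 : f - f' = ‖x‖ • (‖x‖⁻¹ • f - ‖x'‖⁻¹ • f') + ((‖x‖ - ‖x'‖) * ‖x'‖⁻¹) • f' := by
      rw [smul_sub, smul_smul, smul_smul, mul_inv_cancel₀ hx0.ne', one_smul, sub_mul, sub_smul _ _ f',
        mul_inv_cancel₀ hx0'.ne', one_smul]
      abel
    rw [h2]
    refine (norm_add_le _ _).trans ?_
    rw [norm_smul, norm_smul, norm_mul, hfn', norm_inv, norm_norm, norm_norm, mul_assoc,
      inv_mul_cancel₀ hx0'.ne', mul_one]
    have h3 : ‖(‖x‖ - ‖x'‖ : ℝ)‖ ≤ ε / 4 := by rw [Real.norm_eq_abs, abs_le]; exact habs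
    have h4 : ‖x‖ * ‖‖x‖⁻¹ • f - ‖x'‖⁻¹ • f'‖ ≤ R' * (ε / (2 * R')) :=
      mul_le_mul (hx.trans (le_max_left _ _)) h1 (norm_nonneg _) (by positivity)
    have h5 : R' * (ε / (2 * R')) = ε / 2 := by field_simp
    linarith
  · have h2 : ‖x‖⁻¹ • x - ‖x'‖⁻¹ • x' =
        ‖x‖⁻¹ • (x - x') + (‖x‖⁻¹ * (‖x'‖ - ‖x‖) * ‖x'‖⁻¹) • x' := by
      have : ‖x‖⁻¹ * (‖x'‖ - ‖x‖) * ‖x'‖⁻¹ = ‖x‖⁻¹ - ‖x'‖⁻¹ := by field_simp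
      rw [this]; module
    rw [h2]
    refine (norm_add_le _ _).trans ?_
    rw [norm_smul, norm_smul, norm_mul, norm_mul, norm_inv, norm_inv, norm_norm, norm_norm,
      mul_assoc, mul_assoc, inv_mul_cancel₀ hx0'.ne', mul_one, ← mul_add, inv_mul_le_iff₀ hx0]
    have h3 : ‖(‖x'‖ - ‖x‖ : ℝ)‖ ≤ ‖x - x'‖ := by
      rw [norm_sub_rev x]; exact abs_norm_sub_norm_le x' x
    nlinarith

theorem IsUniformlySmooth.dualitySet_unique (h : IsUniformlySmooth E) {x : E}
    {f g : StrongDual ℝ E} (hf : f ∈ dualitySet x) (hg : g ∈ dualitySet x) : f = g := by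
  rw [← sub_eq_zero, ← norm_le_zero_iff]
  refine le_of_forall_pos_le_add fun ε hε => ?_
  obtain ⟨δ, hδ, H⟩ := h.norm_sub_le_of_bounded ‖x‖ hε
  rw [zero_add]
  exact H x x le_rfl (by simpa using hδ.le) f hf g hg

theorem IsUniformlySmooth.eq_J (h : IsUniformlySmooth E) {x : E} {f : StrongDual ℝ E}
    (hf : f ∈ dualitySet x) : f = J x := h.dualitySet_unique hf (J_mem x)

theorem IsUniformlySmooth.tendsto_J_sub_J (h : IsUniformlySmooth E) {ι : Type*} {l : Filter ι}
    {x y : ι → E} {R : ℝ} (hx : ∀ i, ‖x i‖ ≤ R) (hxy : Tendsto (fun i => x i - y i) l (𝓝 0)) :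
    Tendsto (fun i => J (x i) - J (y i)) l (𝓝 0) := by
  rw [Metric.tendsto_nhds] at hxy ⊢
  intro ε hε
  obtain ⟨δ, hδ, H⟩ := h.norm_sub_le_of_bounded R (half_pos hε)
  filter_upwards [hxy δ hδ] with i hi
  rw [dist_zero_right] at hi ⊢
  exact (H _ _ (hx i) hi.le _ (J_mem _) _ (J_mem _)).trans_lt (half_lt_self hε)

theorem IsUniformlySmooth.continuous_J (h : IsUniformlySmooth E) :
    Continuous (J : E → StrongDual ℝ E) := by
  refine continuous_iff_continuousAt.2 fun x => ?_
  have := h.tendsto_J_sub_J (l := 𝓝 x) (x := fun _ => x) (y := id) (R := ‖x‖) (fun _ => le_rfl)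
    (by simpa using (continuous_const.sub continuous_id).tendsto (f := fun y : E => x - y) x)
  rw [ContinuousAt]
  simpa using this.const_sub (J x)

end Smoothness

/-! ### Goldstine and Milman–Pettis -/

section Reflexivity

variable {E : Type*} [NormedAddCommGroup E] [NormedSpace ℝ E]

/-- Helly's form of Goldstine's theorem. -/
theorem exists_approx_bidual (F : StrongDual ℝ (StrongDual ℝ E)) (hF : ‖F‖ ≤ 1)
    (s : Finset (StrongDual ℝ E)) {ε : ℝ} (hε : 0 < ε) :
    ∃ x : E, ‖x‖ ≤ 1 ∧ ∀ f ∈ s, |f x - F f| < ε := by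
  classical
  let Φ : E →ₗ[ℝ] (s → ℝ) := LinearMap.pi fun f => (f.1 : E →ₗ[ℝ] ℝ)
  by_cases hmem : (fun f : s => F f.1) ∈ closure (Φ '' Metric.closedBall 0 1)
  · obtain ⟨_, ⟨x, hx, rfl⟩, hd⟩ := Metric.mem_closure_iff.1 hmem ε hε
    refine ⟨x, by simpa using hx, fun f hf => ?_⟩
    have := (dist_le_pi_dist _ _ (⟨f, hf⟩ : s)).trans_lt hd
    rwa [dist_comm, Real.dist_eq] at this
  · exfalso
    have hconvex : Convex ℝ (closure (Φ '' Metric.closedBall 0 1)) :=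
      ((convex_closedBall 0 1).linear_image Φ).closure
    obtain ⟨c, u, hc, hu⟩ := geometric_hahn_banach_closed_point hconvex isClosed_closure hmem
    have hsum : ∀ v : s → ℝ, c v = ∑ i, v i * c (Pi.single i 1) := by
      intro v
      conv_lhs => rw [← Finset.univ_sum_single v]
      rw [map_sum]
      refine Finset.sum_congr rfl fun i _ => ?_
      have : (Pi.single i (v i) : s → ℝ) = v i • Pi.single i (1 : ℝ) := by
        rw [← Pi.single_smul, smul_eq_mul, mul_one]
      rw [this, map_smul, smul_eq_mul]
    -- The separating functional on `ℝ^s` pulls back to `g` with `‖g‖ ≤ u < F g`, contradicting `‖F‖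
    -- ≤ 1`.
    let g : StrongDual ℝ E := ∑ i : s, c (Pi.single i 1) • i.1
    have hg : ∀ x, g x = c (Φ x) := by
      intro x
      rw [hsum]
      simp [g, Φ, mul_comm]
    have hFg : F g = c (fun f : s => F f.1) := by
      rw [hsum]
      simp [g, mul_comm]
    have hball : ∀ x : E, ‖x‖ ≤ 1 → g x ≤ u := fun x hx => by
      rw [hg]; exact (hc _ (subset_closure ⟨x, by simpa using hx, rfl⟩)).le
    have hu0 : 0 ≤ u := by simpa using hball 0 (by simp)
    have hgn : ‖g‖ ≤ u := by
      refine ContinuousLinearMap.opNorm_le_of_unit_norm hu0 fun x hx => ?_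
      rw [Real.norm_eq_abs, abs_le]
      have h1 := hball x hx.le
      have h2 := hball (-x) (by simpa using hx.le)
      rw [map_neg] at h2
      constructor <;> linarith
    have h3 : F g ≤ ‖g‖ := by
      have := (le_abs_self _).trans (F.le_opNorm g)
      nlinarith [norm_nonneg g]
    linarith

theorem exists_mem_dualitySet
    (hrefl : Function.Surjective (NormedSpace.inclusionInDoubleDual ℝ E)) (f : StrongDual ℝ E) :
    ∃ x : E, f ∈ dualitySet x := by
  obtain ⟨F, hF⟩ := dualitySet_nonempty f
  obtain ⟨x, rfl⟩ := hrefl F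
  have hn : ‖NormedSpace.inclusionInDoubleDual ℝ E x‖ = ‖x‖ :=
    (NormedSpace.inclusionInDoubleDualLi ℝ (E := E)).norm_map x
  have h1 := hF.1
  have h2 := hF.2
  rw [hn] at h1 h2
  exact ⟨x, by rw [← NormedSpace.dual_def ℝ, h1, h2], h2.symm⟩

variable [CompleteSpace E]

/-- The Milman–Pettis theorem for 2-uniformly convex spaces. -/
theorem inclusionInDoubleDual_surjective {m : ℝ} (hm : 0 < m)
    (hU : ∀ x y : E, ‖x‖ ^ 2 + m * ‖y‖ ^ 2 ≤ (‖x + y‖ ^ 2 + ‖x - y‖ ^ 2) / 2) :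
    Function.Surjective (NormedSpace.inclusionInDoubleDual ℝ E) := by
  have hone : ∀ F : StrongDual ℝ (StrongDual ℝ E), ‖F‖ = 1 →
      ∃ x : E, NormedSpace.inclusionInDoubleDual ℝ E x = F := by
    intro F hF
    classical
    have hex : ∀ i : Finset (StrongDual ℝ E) × ℕ, ∃ x : E, ‖x‖ ≤ 1 ∧
        ∀ f ∈ i.1, |f x - F f| < 1 / ((i.2 : ℝ) + 1) := fun i =>
      exists_approx_bidual F hF.le i.1 (by positivity)
    choose x hx1 hx2 using hex
    have hlim : ∀ f : StrongDual ℝ E, Tendsto (fun i => f (x i)) atTop (𝓝 (F f)) := by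
      intro f
      rw [Metric.tendsto_atTop]
      intro ε hε
      obtain ⟨n, hn⟩ := exists_nat_one_div_lt hε
      refine ⟨({f}, n), fun i hi => ?_⟩
      rw [Real.dist_eq]
      refine (hx2 i f (hi.1 (by simp))).trans (lt_of_le_of_lt ?_ hn)
      have : (n : ℝ) ≤ i.2 := by exact_mod_cast hi.2
      gcongr
    -- A functional `f` almost norming `F` makes `‖x i + x j‖` close to `2`, so convexity makes `x i
    -- - x j` small.
    have hcauchy : CauchySeq x := by
      rw [Metric.cauchySeq_iff]
      intro ε hε
      set δ := min 1 (m * ε ^ 2 / 16) with hδ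
      have hδ0 : 0 < δ := by positivity
      obtain ⟨f, hf1, hf2⟩ : ∃ f : StrongDual ℝ E, ‖f‖ ≤ 1 ∧ 1 - δ < F f := by
        obtain ⟨f, hf1, hf2⟩ := F.exists_lt_apply_of_lt_opNorm (r := 1 - δ) (by rw [hF]; linarith)
        rcases le_total 0 (F f) with h | h
        · exact ⟨f, hf1.le, by rwa [Real.norm_of_nonneg h] at hf2⟩
        · exact ⟨-f, by simpa using hf1.le, by rwa [Real.norm_of_nonpos h, ← map_neg] at hf2⟩
      have hev := (hlim f).eventually (lt_mem_nhds hf2)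
      obtain ⟨N, hN⟩ := eventually_atTop.1 hev
      refine ⟨N, fun i hi j hj => ?_⟩
      have h1 : f (x i + x j) ≤ ‖x i + x j‖ := by
        have := (le_abs_self _).trans (f.le_opNorm (x i + x j))
        nlinarith [norm_nonneg (x i + x j)]
      rw [map_add] at h1
      have h2 : 2 - 2 * δ < ‖x i + x j‖ := by linarith [hN i hi, hN j hj]
      have h3 := hU ((1 / 2 : ℝ) • (x i + x j)) ((1 / 2 : ℝ) • (x i - x j))
      have h4 : (1 / 2 : ℝ) • (x i + x j) + (1 / 2 : ℝ) • (x i - x j) = x i := by module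
      have h5 : (1 / 2 : ℝ) • (x i + x j) - (1 / 2 : ℝ) • (x i - x j) = x j := by module
      rw [h4, h5, norm_smul, norm_smul, Real.norm_of_nonneg (by norm_num)] at h3
      have h6 : ‖x i‖ ^ 2 ≤ 1 := pow_le_one₀ (norm_nonneg _) (hx1 i)
      have h7 : ‖x j‖ ^ 2 ≤ 1 := pow_le_one₀ (norm_nonneg _) (hx1 j)
      have hδ1 : δ ≤ 1 := min_le_left _ _
      have hδ2 : δ ≤ m * ε ^ 2 / 16 := min_le_right _ _
      have h8 : (1 - δ) ^ 2 ≤ (1 / 2 * ‖x i + x j‖) ^ 2 :=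
        pow_le_pow_left₀ (by linarith) (by linarith) 2
      have h9 : m * (‖x i - x j‖ ^ 2) < m * ε ^ 2 := by
        nlinarith [mul_pos hm (sq_pos_of_pos hε)]
      rw [dist_eq_norm]
      exact lt_of_pow_lt_pow_left₀ 2 hε.le (lt_of_mul_lt_mul_left h9 hm.le)
    obtain ⟨z, hz⟩ := cauchySeq_tendsto_of_complete hcauchy
    refine ⟨z, ContinuousLinearMap.ext fun f => ?_⟩
    exact tendsto_nhds_unique ((f.continuous.tendsto z).comp hz) (hlim f)
  intro F
  rcases eq_or_ne F 0 with rfl | hF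
  · exact ⟨0, map_zero _⟩
  have hF0 : ‖F‖ ≠ 0 := fun h => hF (F.opNorm_zero_iff.1 h)
  obtain ⟨x, hx⟩ := hone (‖F‖⁻¹ • F)
    (norm_smul_inv_norm (𝕜 := ℝ) (E := StrongDual ℝ (StrongDual ℝ E)) hF)
  exact ⟨‖F‖ • x, by rw [map_smul, hx, smul_smul, mul_inv_cancel₀ hF0, one_smul]⟩

end Reflexivity

/-! ### 2-uniform smoothness of the dual -/

section DualSmoothness

variable {E : Type*} [NormedAddCommGroup E] [NormedSpace ℝ E]

/-- The dual of a 2-uniformly convex reflexive space is 2-uniformly smooth. -/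
theorem dual_add_sq_le {m : ℝ} (hm : 0 < m)
    (hU : ∀ x y : E, ‖x‖ ^ 2 + m * ‖y‖ ^ 2 ≤ (‖x + y‖ ^ 2 + ‖x - y‖ ^ 2) / 2)
    (hrefl : Function.Surjective (NormedSpace.inclusionInDoubleDual ℝ E))
    {z : E} {f : StrongDual ℝ E} (hf : f ∈ dualitySet z) (g : StrongDual ℝ E) :
    ‖f + g‖ ^ 2 ≤ ‖f‖ ^ 2 + 2 * g z + m⁻¹ * ‖g‖ ^ 2 := by
  -- Reflexivity lets `f + g` be represented at a point `w`. The convexity bound at `z` towards `w`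
  -- and Young's inequality then give the dual estimate.
  obtain ⟨w, hw⟩ := exists_mem_dualitySet hrefl (f + g)
  have h1 := dualitySet_add_sq_le hU hf (w - z)
  have h2 := dualitySet_apply_self hw
  have h3 := dualitySet_apply_self hf
  rw [add_sub_cancel, map_sub, h3] at h1
  rw [add_apply] at h2
  rw [hw.2, hf.2]
  have h4 : g w - g z ≤ ‖g‖ * ‖w - z‖ := by
    rw [← map_sub]; exact (le_abs_self _).trans (g.le_opNorm _)
  have h5 : 2 * (‖g‖ * ‖w - z‖) ≤ m⁻¹ * ‖g‖ ^ 2 + m * ‖w - z‖ ^ 2 := by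
    have h6 : m⁻¹ * ‖g‖ ^ 2 + m * ‖w - z‖ ^ 2 - 2 * (‖g‖ * ‖w - z‖) =
        m⁻¹ * (‖g‖ - m * ‖w - z‖) ^ 2 := by field_simp; ring
    have h7 : 0 ≤ m⁻¹ * (‖g‖ - m * ‖w - z‖) ^ 2 := by positivity
    linarith
  linarith

theorem twoUniformSmoothnessConst_dual_spec {m : ℝ} (hm : 0 < m)
    (hU : ∀ x y : E, ‖x‖ ^ 2 + m * ‖y‖ ^ 2 ≤ (‖x + y‖ ^ 2 + ‖x - y‖ ^ 2) / 2)
    (hrefl : Function.Surjective (NormedSpace.inclusionInDoubleDual ℝ E)) :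
    1 / √2 ≤ twoUniformSmoothnessConst (StrongDual ℝ E) ∧
      ∀ z : E, ∀ f ∈ dualitySet z, ∀ g : StrongDual ℝ E,
        ‖f + g‖ ^ 2 ≤ ‖f‖ ^ 2 + 2 * g z +
          2 * twoUniformSmoothnessConst (StrongDual ℝ E) ^ 2 * ‖g‖ ^ 2 := by
  set S := {k : ℝ | 1 / √2 ≤ k ∧ ∀ x y : StrongDual ℝ E, ∀ j ∈ dualitySet x,
    ‖x + y‖ ^ 2 ≤ ‖x‖ ^ 2 + 2 * j y + 2 * k ^ 2 * ‖y‖ ^ 2} with hS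
  have hcl : IsClosed S := by
    have : S = Set.Ici (1 / √2) ∩ ⋂ (x : StrongDual ℝ E) (y : StrongDual ℝ E)
        (j ∈ dualitySet x),
        {k : ℝ | ‖x + y‖ ^ 2 ≤ ‖x‖ ^ 2 + 2 * j y + 2 * k ^ 2 * ‖y‖ ^ 2} := by
      ext k
      simp [hS]
    rw [this]
    refine isClosed_Ici.inter (isClosed_iInter fun x => isClosed_iInter fun y =>
      isClosed_iInter fun j => isClosed_iInter fun _ => ?_)
    exact isClosed_le (by fun_prop) (by fun_prop)
  have hne : S.Nonempty := by
    -- Any `k ≥ 1/√2` with `2k² ≥ m⁻¹` is admissible.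
    refine ⟨1 + m⁻¹, ?_, fun f g j hj => ?_⟩
    · have h1 : 1 / √2 ≤ 1 := by
        rw [div_le_one (by positivity)]; exact Real.one_le_sqrt.2 (by norm_num)
      have : 0 < m⁻¹ := by positivity
      linarith
    · obtain ⟨z, rfl⟩ := hrefl j
      have hn : ‖NormedSpace.inclusionInDoubleDual ℝ E z‖ = ‖z‖ :=
        (NormedSpace.inclusionInDoubleDualLi ℝ (E := E)).norm_map z
      have h1 := hj.1
      have h2 := hj.2
      rw [hn] at h1 h2
      rw [NormedSpace.dual_def] at h1
      have h3 := dual_add_sq_le hm hU hrefl (z := z) (f := f) ⟨h1.trans h2, h2.symm⟩ g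
      rw [NormedSpace.dual_def]
      refine h3.trans ?_
      have h4 : m⁻¹ ≤ 2 * (1 + m⁻¹) ^ 2 := by
        have : 0 < m⁻¹ := by positivity
        nlinarith
      gcongr
  obtain ⟨h1, h2⟩ := hcl.csInf_mem hne ⟨1 / √2, fun k hk => hk.1⟩
  exact ⟨h1, fun z f hf g => h2 f g _ (inclusion_mem_dualitySet hf)⟩

end DualSmoothness

/-! ### Weak convergence and sequential compactness -/

section WeakCompactness

variable {E : Type*} [NormedAddCommGroup E] [NormedSpace ℝ E]

theorem weaklyConverges_iff {x : ℕ → E} {z : E} :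
    WeaklyConverges x z ↔ ∀ f : StrongDual ℝ E, Tendsto (fun n => f (x n)) atTop (𝓝 (f z)) := by
  have hinj : Function.Injective (topDualPairing ℝ E).flip := fun u v h =>
    (SeparatingDual.eq_iff_forall_dual_eq (R := ℝ)).2 fun f => LinearMap.congr_fun h f
  exact WeakBilin.tendsto_iff_forall_eval_tendsto _ hinj

theorem weakStarConverges_iff {f : ℕ → StrongDual ℝ E} {g : StrongDual ℝ E} :
    WeakStarConverges f g ↔ ∀ x : E, Tendsto (fun n => f n x) atTop (𝓝 (g x)) :=
  tendsto_iff_forall_eval_tendsto_topDualPairing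

theorem mem_of_weak_tendsto {ι : Type*} {l : Filter ι} [l.NeBot] {C : Set E} (hC : Convex ℝ C)
    (hcl : IsClosed C) {x : ι → E} (hx : ∀ i, x i ∈ C) {z : E}
    (hz : ∀ f : StrongDual ℝ E, Tendsto (fun i => f (x i)) l (𝓝 (f z))) : z ∈ C := by
  by_contra hzC
  obtain ⟨f, u, h1, h2⟩ := geometric_hahn_banach_point_closed hC hcl hzC
  exact absurd (ge_of_tendsto' (hz f) fun i => (h2 _ (hx i)).le) (not_le.2 h1)

theorem exists_weak_limit_ultrafilter
    (hrefl : Function.Surjective (NormedSpace.inclusionInDoubleDual ℝ E))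
    {ι : Type*} {x : ι → E} {R : ℝ} (hx : ∀ i, ‖x i‖ ≤ R) (U : Ultrafilter ι) :
    ∃ z : E, ∀ f : StrongDual ℝ E, Tendsto (fun i => f (x i)) U (𝓝 (f z)) := by
  let T : ι → WeakDual ℝ (StrongDual ℝ E) := fun i =>
    StrongDual.toWeakDual (NormedSpace.inclusionInDoubleDual ℝ E (x i))
  have hK := WeakDual.isCompact_closedBall (𝕜 := ℝ) (E := StrongDual ℝ E) 0 R
  obtain ⟨G, -, hG⟩ := isCompact_iff_ultrafilter_le_nhds.1 hK (U.map T) (by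
    rw [le_principal_iff]
    refine Filter.mem_map.2 (Filter.univ_mem' fun i => ?_)
    simp only [Set.mem_preimage, mem_closedBall_zero_iff]
    exact (NormedSpace.double_dual_bound ℝ E (x i)).trans (hx i))
  obtain ⟨z, hz⟩ := hrefl (WeakDual.toStrongDual G)
  refine ⟨z, fun f => ?_⟩
  have h1 : Tendsto T U (𝓝 G) := hG
  have h2 := tendsto_iff_forall_eval_tendsto_topDualPairing.1 h1 f
  have h3 : f z = (WeakDual.toStrongDual G) f := by rw [← hz]; rfl
  rw [h3]
  exact h2

/-- Bounded sequences in a smooth reflexive space have weakly convergent subsequences. -/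
theorem exists_weaklyConverges_subseq
    (hrefl : Function.Surjective (NormedSpace.inclusionInDoubleDual ℝ E))
    (hJ : Continuous (J : E → StrongDual ℝ E))
    {x : ℕ → E} {R : ℝ} (hx : ∀ n, ‖x n‖ ≤ R) :
    ∃ z : E, ∃ φ : ℕ → ℕ, StrictMono φ ∧ WeaklyConverges (fun k => x (φ k)) z := by
  -- All weak limits stay in this separable subspace, where the functionals `J (q i)` at a dense
  -- sequence separate points: if they all kill `d ∈ M`, continuity of `J` gives `J d d = ‖d‖² = 0`.
  -- Convergence against these countably many functionals hence forces all ultrafilter limits to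
  -- agree.
  let M := (Submodule.span ℝ (Set.range x)).topologicalClosure
  have hMx : ∀ n, x n ∈ M := fun n =>
    Submodule.le_topologicalClosure _ (Submodule.subset_span ⟨n, rfl⟩)
  have hMcl : IsClosed (M : Set E) := Submodule.isClosed_topologicalClosure _
  have hsep : TopologicalSpace.IsSeparable (M : Set E) := by
    rw [Submodule.topologicalClosure_coe]
    exact (Set.countable_range x).isSeparable.span.closure
  obtain ⟨c, hc, hMc⟩ := hsep
  have hc0 : c.Nonempty := by
    by_contra h
    rw [Set.not_nonempty_iff_eq_empty] at h
    simpa [h] using hMc (hMx 0)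
  obtain ⟨q, rfl⟩ := hc.exists_eq_range hc0
  have hcomp : IsCompact (Set.univ.pi fun i => Set.Icc (-(‖q i‖ * R)) (‖q i‖ * R)) :=
    isCompact_univ_pi fun i => isCompact_Icc
  obtain ⟨a, -, φ, hφ, hlim⟩ := hcomp.tendsto_subseq (x := fun n i => J (q i) (x n))
    (fun n i _ => by
      have h1 := (J (q i)).le_opNorm (x n)
      rw [J_norm] at h1
      have h2 : ‖q i‖ * ‖x n‖ ≤ ‖q i‖ * R := by gcongr; exact hx n
      exact abs_le.1 (h1.trans h2))
  rw [tendsto_pi_nhds] at hlim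
  have hex := fun U : Ultrafilter ℕ =>
    exists_weak_limit_ultrafilter hrefl (x := fun k => x (φ k)) (fun k => hx (φ k)) U
  choose ζ hζ using hex
  have hzM : ∀ U, ζ U ∈ M := fun U =>
    mem_of_weak_tendsto M.convex hMcl (fun k => hMx (φ k)) (hζ U)
  have huniq : ∀ U V : Ultrafilter ℕ, (U : Filter ℕ) ≤ atTop → (V : Filter ℕ) ≤ atTop →
      ζ U = ζ V := by
    intro U V hU hV
    have hq : ∀ i, J (q i) (ζ U - ζ V) = 0 := fun i => by
      rw [map_sub, tendsto_nhds_unique (hζ U (J (q i))) ((hlim i).mono_left hU),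
        tendsto_nhds_unique (hζ V (J (q i))) ((hlim i).mono_left hV), sub_self]
    have hcl : IsClosed {p : E | J p (ζ U - ζ V) = 0} :=
      isClosed_eq (hJ.clm_apply continuous_const) continuous_const
    have hmem : ζ U - ζ V ∈ {p : E | J p (ζ U - ζ V) = 0} :=
      closure_minimal (by rintro _ ⟨i, rfl⟩; exact hq i) hcl (hMc (M.sub_mem (hzM U) (hzM V)))
    have h0 : J (ζ U - ζ V) (ζ U - ζ V) = 0 := hmem
    rw [J_self, sq_eq_zero_iff, norm_eq_zero, sub_eq_zero] at h0
    exact h0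
  refine ⟨ζ (Ultrafilter.of atTop), φ, hφ, weaklyConverges_iff.2 fun f => ?_⟩
  rw [tendsto_iff_ultrafilter]
  intro U hU
  rw [huniq (Ultrafilter.of atTop) U (Ultrafilter.of_le _) hU]
  exact hζ U f

end WeakCompactness

/-! ### Maximal monotone operators and surjectivity -/

section MaximalMonotone

variable {E : Type*} [NormedAddCommGroup E] [NormedSpace ℝ E]

theorem IsMaximalMonotone.mem_of_forall {B : E → Set (StrongDual ℝ E)} (hB : IsMaximalMonotone B)
    {z : E} {f : StrongDual ℝ E} (h : ∀ w, ∀ v ∈ B w, 0 ≤ (f - v) (z - w)) : f ∈ B z := by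
  have hS := hB.2 (fun x => B x ∪ {g | x = z ∧ g = f}) ?_ fun x => Set.subset_union_left
  · rw [congrFun hS z]
    exact Or.inr ⟨rfl, rfl⟩
  · rintro x y u (hu | ⟨rfl, rfl⟩) v (hv | ⟨rfl, rfl⟩)
    · exact hB.1 x y u hu v hv
    · have := h x u hu
      rwa [← neg_sub u, ← neg_sub x, neg_apply, map_neg, neg_neg] at this
    · exact h y v hv
    · simp

/-- The separation step in the proof of Rockafellar's surjectivity theorem: a maximal monotone
operator has an affine minorant of its Fitzpatrick function dominating `-(‖x‖² + ‖f‖²) / 2`. -/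
theorem exists_separating {B : E → Set (StrongDual ℝ E)}
    (hmono : IsMonotoneOperator B)
    (hmax : ∀ z f, (∀ w, ∀ v ∈ B w, 0 ≤ (f - v) (z - w)) → f ∈ B z)
    (hne : ∃ w, (B w).Nonempty) :
    ∃ (G : StrongDual ℝ E) (F : StrongDual ℝ (StrongDual ℝ E)), ∀ x f w, ∀ v ∈ B w,
      -G x - F f - ‖x‖ ^ 2 / 2 - ‖f‖ ^ 2 / 2 ≤ v w - G w - F v := by
  let k : E × StrongDual ℝ E → ℝ := fun p => ‖p.1‖ ^ 2 / 2 + ‖p.2‖ ^ 2 / 2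
  -- `s` is the strict hypograph of `-k` and `t` the epigraph of the Fitzpatrick function of `B`.
  -- They are disjoint since maximality puts that function above the pairing `f x`, and `f x ≥ -k
  -- (x, f)`.
  let s : Set ((E × StrongDual ℝ E) × ℝ) := {p | k p.1 + p.2 < 0}
  let t : Set ((E × StrongDual ℝ E) × ℝ) :=
    {p | ∀ w, ∀ v ∈ B w, p.1.2 w + v p.1.1 - v w ≤ p.2}
  have hs_open : IsOpen s := isOpen_lt (by fun_prop) continuous_const
  have hk : ConvexOn ℝ Set.univ k := by
    have h1 : ConvexOn ℝ Set.univ fun x : E => ‖x‖ ^ 2 / 2 := by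
      simpa [div_eq_inv_mul] using ((convexOn_univ_norm.pow (fun _ _ => norm_nonneg _) 2).smul
        (by norm_num : (0 : ℝ) ≤ 2⁻¹) : ConvexOn ℝ Set.univ fun x : E => (2 : ℝ)⁻¹ • ‖x‖ ^ 2)
    have h2 : ConvexOn ℝ Set.univ fun x : StrongDual ℝ E => ‖x‖ ^ 2 / 2 := by
      simpa [div_eq_inv_mul] using ((convexOn_univ_norm.pow (fun _ _ => norm_nonneg _) 2).smul
        (by norm_num : (0 : ℝ) ≤ 2⁻¹) :
          ConvexOn ℝ Set.univ fun x : StrongDual ℝ E => (2 : ℝ)⁻¹ • ‖x‖ ^ 2)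
    exact (h1.comp_linearMap (LinearMap.fst ℝ E (StrongDual ℝ E))).add
      (h2.comp_linearMap (LinearMap.snd ℝ E (StrongDual ℝ E)))
  have hs_conv : Convex ℝ s := by
    intro p hp q hq a b ha hb hab
    have h1 := hk.2 (Set.mem_univ p.1) (Set.mem_univ q.1) ha hb hab
    have hp' : k p.1 + p.2 < 0 := hp
    have hq' : k q.1 + q.2 < 0 := hq
    change k (a • p.1 + b • q.1) + (a * p.2 + b * q.2) < 0
    simp only [smul_eq_mul] at h1
    rcases ha.eq_or_lt with rfl | ha'
    · have : b = 1 := by linarith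
      subst this; nlinarith
    · nlinarith [mul_neg_of_pos_of_neg ha' hp', mul_nonpos_of_nonneg_of_nonpos hb hq'.le]
  have ht_conv : Convex ℝ t := by
    intro p hp q hq a b ha hb hab w v hv
    have h1 := mul_le_mul_of_nonneg_left (hp w v hv) ha
    have h2 := mul_le_mul_of_nonneg_left (hq w v hv) hb
    have h3 : v w = a * v w + b * v w := by rw [← add_mul, hab, one_mul]
    change (a • p.1.2 + b • q.1.2) w + v (a • p.1.1 + b • q.1.1) - v w ≤ a * p.2 + b * q.2
    rw [map_add, map_smul, map_smul, add_apply, smul_apply, smul_apply, smul_eq_mul, smul_eq_mul,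
      smul_eq_mul, smul_eq_mul]
    linarith
  have hdisj : Disjoint s t := by
    rw [Set.disjoint_left]
    rintro ⟨⟨x, f⟩, r⟩ hs ht
    have hr : f x ≤ r := by
      by_contra hlt
      push Not at hlt
      have hmem : f ∈ B x := hmax x f fun w v hv => by
        have := ht w v hv
        simp only at this
        simp only [sub_apply, map_sub]
        linarith
      have := ht x f hmem
      simp only at this
      linarith
    have h1 : ‖x‖ ^ 2 / 2 + ‖f‖ ^ 2 / 2 + r < 0 := hs
    have h2 := neg_le_of_abs_le (f.le_opNorm x)
    nlinarith [sq_nonneg (‖x‖ - ‖f‖)]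
  obtain ⟨Λ, u, hΛs, hΛt⟩ := geometric_hahn_banach_open hs_conv hs_open ht_conv hdisj
  have hΛ : ∀ x f r, Λ ((x, f), r) = Λ ((x, 0), 0) + Λ ((0, f), 0) + r * Λ ((0, 0), 1) := by
    intro x f r
    have : (((x, f), r) : (E × StrongDual ℝ E) × ℝ) =
        ((x, 0), 0) + ((0, f), 0) + r • ((0, 0), 1) := by simp
    conv_lhs => rw [this]
    rw [map_add, map_add, map_smul, smul_eq_mul]
  set τ := Λ ((0, 0), 1) with hτ
  have hgraph : ∀ w, ∀ v ∈ B w, u ≤ Λ ((w, v), v w) := fun w v hv =>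
    hΛt _ fun w' v' hv' => by
      have := hmono w w' v hv v' hv'
      simp only [sub_apply, map_sub] at this
      simp only
      linarith
  have hhyp : ∀ x f r, r < -k (x, f) → Λ ((x, f), r) < u := fun x f r hr =>
    hΛs _ (by change k (x, f) + r < 0; linarith)
  obtain ⟨w₀, v₀, hv₀⟩ := hne
  -- The hyperplane is not vertical: over a graph point, `s` contains a point below one of `t`.
  have hτpos : 0 < τ := by
    have h1 := hgraph w₀ v₀ hv₀
    set r := min (v₀ w₀ - 1) (-k (w₀, v₀) - 1) with hr
    have h2 := hhyp w₀ v₀ r (lt_of_le_of_lt (min_le_right _ _) (by linarith))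
    have h3 : r < v₀ w₀ := lt_of_le_of_lt (min_le_left _ _) (by linarith)
    rw [hΛ] at h1 h2
    by_contra h
    nlinarith
  have hcl : ∀ x f, Λ ((x, f), -k (x, f)) ≤ u := by
    intro x f
    refine le_of_forall_pos_lt_add fun ε hε => ?_
    have h1 := hhyp x f (-k (x, f) - ε / τ) (by have := div_pos hε hτpos; linarith)
    rw [hΛ] at h1 ⊢
    rw [sub_mul, div_mul_cancel₀ _ hτpos.ne'] at h1
    linarith
  let i₁ : E →L[ℝ] (E × StrongDual ℝ E) × ℝ :=
    (ContinuousLinearMap.inl ℝ (E × StrongDual ℝ E) ℝ).comp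
      (ContinuousLinearMap.inl ℝ E (StrongDual ℝ E))
  let i₂ : StrongDual ℝ E →L[ℝ] (E × StrongDual ℝ E) × ℝ :=
    (ContinuousLinearMap.inl ℝ (E × StrongDual ℝ E) ℝ).comp
      (ContinuousLinearMap.inr ℝ E (StrongDual ℝ E))
  refine ⟨-(τ⁻¹ • Λ.comp i₁), -(τ⁻¹ • Λ.comp i₂), fun x f w v hv => ?_⟩
  have h1 := (hcl x f).trans (hgraph w v hv)
  rw [hΛ, hΛ w v] at h1
  have e1 : ∀ x, (-(τ⁻¹ • Λ.comp i₁)) x = -(τ⁻¹ * Λ ((x, 0), 0)) := fun _ => rfl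
  have e2 : ∀ f, (-(τ⁻¹ • Λ.comp i₂)) f = -(τ⁻¹ * Λ ((0, f), 0)) := fun _ => rfl
  rw [e1, e1, e2, e2]
  have h2 := mul_le_mul_of_nonneg_left h1 (inv_nonneg.2 hτpos.le)
  rw [mul_add, mul_add, mul_add, mul_add, mul_comm _ τ, inv_mul_cancel_left₀ hτpos.ne',
    mul_comm _ τ, inv_mul_cancel_left₀ hτpos.ne'] at h2
  simp only [k] at h2
  linarith

/-- Rockafellar's theorem: `0` is in the range of `B + J`. -/
theorem exists_neg_mem_dualitySet
    (hrefl : Function.Surjective (NormedSpace.inclusionInDoubleDual ℝ E))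
    {B : E → Set (StrongDual ℝ E)} (hmono : IsMonotoneOperator B)
    (hmax : ∀ z f, (∀ w, ∀ v ∈ B w, 0 ≤ (f - v) (z - w)) → f ∈ B z)
    (hne : ∃ w, (B w).Nonempty) : ∃ z, ∃ f ∈ B z, -f ∈ dualitySet z := by
  obtain ⟨g, F, h⟩ := exists_separating hmono hmax hne
  obtain ⟨y, rfl⟩ := hrefl F
  have key : ∀ w, ∀ v ∈ B w, ‖g‖ ^ 2 / 2 + ‖y‖ ^ 2 / 2 ≤ v w - g w - v y := by
    intro w v hv
    obtain ⟨x, hx⟩ := exists_mem_dualitySet hrefl g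
    -- These arguments maximize the left side, turning the quadratics into their conjugates.
    have h1 := h (-x) (-J y) w v hv
    rw [map_neg, map_neg, NormedSpace.dual_def, NormedSpace.dual_def, J_self, norm_neg, norm_neg,
      J_norm, dualitySet_apply_self hx] at h1
    rw [hx.2]
    linarith
  have hab : -(‖g‖ * ‖y‖) ≤ g y := neg_le_of_abs_le (g.le_opNorm y)
  have hmem : g ∈ B y := hmax y g fun w v hv => by
    have h1 := key w v hv
    have h2 : (g - v) (y - w) = v w - g w - v y + g y := by
      simp only [sub_apply, map_sub]; ring
    rw [h2]
    nlinarith [sq_nonneg (‖g‖ - ‖y‖)]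
  refine ⟨y, g, hmem, ?_⟩
  have h1 := key y g hmem
  have h2 : (‖g‖ - ‖y‖) ^ 2 ≤ 0 := by nlinarith
  have h3 : ‖g‖ = ‖y‖ := by
    have := (sq_eq_zero_iff.1 (le_antisymm h2 (sq_nonneg _))); linarith
  have h4 : -(g y) = ‖y‖ ^ 2 := by rw [h3] at h1 hab; nlinarith
  refine ⟨?_, by rw [norm_neg, h3]⟩
  rw [neg_apply, norm_neg, h3, h4]

/-- Rockafellar's theorem applied to the translated operator `x ↦ B (x + p) - g`. -/
theorem IsMaximalMonotone.exists_add_J_eq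
    (hrefl : Function.Surjective (NormedSpace.inclusionInDoubleDual ℝ E))
    (hsing : ∀ (x : E), ∀ f ∈ dualitySet x, f = J x)
    {B : E → Set (StrongDual ℝ E)} (hB : IsMaximalMonotone B) (hne : ∃ w, (B w).Nonempty)
    (p : E) (g : StrongDual ℝ E) : ∃ z, ∃ v ∈ B z, v + J (z - p) = g := by
  obtain ⟨z, f, hf, hfz⟩ := exists_neg_mem_dualitySet hrefl
    (B := fun x => {v | v + g ∈ B (x + p)})
    (fun x y u hu v hv => by simpa using hB.1 _ _ _ hu _ hv)
    (fun z f h => hB.mem_of_forall fun w v hv => by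
      have := h (w - p) (v - g) (by simpa using hv)
      rwa [← sub_add, sub_add_eq_add_sub, ← sub_add, sub_add_eq_add_sub] at this)
    (by
      obtain ⟨w, v, hv⟩ := hne
      exact ⟨w - p, v - g, by simpa using hv⟩)
  refine ⟨z + p, f + g, hf, ?_⟩
  rw [add_sub_cancel_right, ← hsing z _ hfz]
  abel

/-- A Lipschitz monotone perturbation of a surjective strongly monotone operator is surjective. -/
theorem exists_add_eq_of_strongly_monotone [CompleteSpace E] {C : E → Set (StrongDual ℝ E)} {m : ℝ}
    (hm : 0 < m) (hC : ∀ x y, ∀ u ∈ C x, ∀ v ∈ C y, m * ‖x - y‖ ^ 2 ≤ (u - v) (x - y))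
    (hsurj : ∀ g, ∃ z, g ∈ C z) {A : E → StrongDual ℝ E} {L : ℝ≥0} (hA : IsMonotoneMap A)
    (hL : LipschitzWith L A) (g : StrongDual ℝ E) : ∃ z, ∃ v ∈ C z, A z + v = g := by
  obtain ⟨N, hN⟩ := exists_nat_gt ((L : ℝ) / m)
  have hN0 : (0 : ℝ) < N := lt_of_le_of_lt (by positivity) hN
  rw [div_lt_iff₀ hm] at hN
  set t : ℝ := (N : ℝ)⁻¹ with ht
  have ht0 : 0 < t := by positivity
  have htL : t * L / m < 1 := by
    rw [div_lt_one hm, ht, inv_mul_lt_iff₀ hN0]; exact hN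
  -- Continuation in `N` steps of size `t = 1/N`. Each partial sum `k t A + C` keeps the modulus
  -- `m`, so its inverse is `1/m`-Lipschitz and adding `t A` is a fixed-point problem with
  -- contraction factor `t L / m < 1`.
  have key : ∀ k : ℕ, ∀ g : StrongDual ℝ E, ∃ z, ∃ v ∈ C z, (k * t) • A z + v = g := by
    intro k
    induction k with
    | zero =>
      intro g
      obtain ⟨z, hz⟩ := hsurj g
      exact ⟨z, g, hz, by simp⟩
    | succ k ih =>
      intro g
      choose S v hv hSv using fun w => ih (g - t • A w)
      have hlip : ∀ w w', ‖S w - S w'‖ ≤ t * L / m * ‖w - w'‖ := by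
        intro w w'
        have h1 := hC _ _ _ (hv w) _ (hv w')
        have h2 := hA (S w) (S w')
        have h3 : v w - v w' = (-(t • (A w - A w'))) - (k * t) • (A (S w) - A (S w')) := by
          rw [eq_sub_of_add_eq' (hSv w), eq_sub_of_add_eq' (hSv w')]
          module
        have h4 : 0 ≤ ((k * t) • (A (S w) - A (S w'))) (S w - S w') := by
          rw [smul_apply, smul_eq_mul]
          positivity
        have h5 : (-(t • (A w - A w'))) (S w - S w') ≤ t * (L * ‖w - w'‖) * ‖S w - S w'‖ := by
          refine (le_abs_self _).trans (((-(t • (A w - A w'))).le_opNorm _).trans ?_)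
          rw [norm_neg, norm_smul, Real.norm_of_nonneg ht0.le]
          gcongr
          rw [← dist_eq_norm, ← dist_eq_norm]
          exact hL.dist_le_mul w w'
        rw [h3, sub_apply] at h1
        have h6 : m * ‖S w - S w'‖ ^ 2 ≤ t * (L * ‖w - w'‖) * ‖S w - S w'‖ := by linarith
        rw [div_mul_eq_mul_div, le_div_iff₀ hm]
        rcases (norm_nonneg (S w - S w')).eq_or_lt with h0 | h0
        · rw [← h0, zero_mul]; positivity
        · refine le_of_mul_le_mul_right ?_ h0
          linarith
      have hcontr : ContractingWith (t * L / m).toNNReal S := by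
        refine ⟨by rw [Real.toNNReal_lt_one]; exact htL, LipschitzWith.of_dist_le_mul fun w w' => ?_⟩
        rw [Real.coe_toNNReal _ (by positivity), dist_eq_norm, dist_eq_norm]
        exact hlip w w'
      have hfix : S (ContractingWith.fixedPoint S hcontr) = ContractingWith.fixedPoint S hcontr :=
        hcontr.fixedPoint_isFixedPt
      set z := ContractingWith.fixedPoint S hcontr
      have h1 := hSv z
      have h2 := hv z
      rw [hfix] at h1 h2
      refine ⟨z, v z, h2, ?_⟩
      rw [← sub_eq_zero, ← sub_eq_zero.2 h1]
      push_cast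
      module
  obtain ⟨z, v, hv, h⟩ := key N g
  rw [ht, mul_inv_cancel₀ hN0.ne', one_smul] at h
  exact ⟨z, v, hv, h⟩

theorem mem_zeroSet_sumOperator {A : E → StrongDual ℝ E} {B : E → Set (StrongDual ℝ E)} {p : E} :
    p ∈ zeroSet (sumOperator A B) ↔ -A p ∈ B p := by
  constructor
  · rintro ⟨v, hv, h⟩
    rwa [← eq_neg_of_add_eq_zero_right h]
  · exact fun h => ⟨_, h, add_neg_cancel _⟩

variable [CompleteSpace E]

/-- Minty's characterization of the zeros of `A + B`, expressing its maximal monotonicity. -/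
theorem mem_zeroSet_iff_forall {m : ℝ} (hm : 0 < m)
    (hU : ∀ x y : E, ‖x‖ ^ 2 + m * ‖y‖ ^ 2 ≤ (‖x + y‖ ^ 2 + ‖x - y‖ ^ 2) / 2)
    (hsing : ∀ (x : E), ∀ f ∈ dualitySet x, f = J x)
    {A : E → StrongDual ℝ E} {B : E → Set (StrongDual ℝ E)} {L : ℝ≥0}
    (hB : IsMaximalMonotone B) (hA : IsMonotoneMap A) (hL : LipschitzWith L A)
    (hne : ∃ w, (B w).Nonempty) {p : E} :
    p ∈ zeroSet (sumOperator A B) ↔ ∀ w, ∀ v ∈ B w, 0 ≤ (A w + v) (w - p) := by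
  constructor
  · intro hp w v hv
    have h1 := hB.1 w p v hv _ (mem_zeroSet_sumOperator.1 hp)
    have h2 := hA w p
    have h3 : A w + v = (v - -A p) + (A w - A p) := by abel
    rw [h3, add_apply]
    exact add_nonneg h1 h2
  · intro h
    have hrefl := inclusionInDoubleDual_surjective hm hU
    -- Solve `0 ∈ A z + B z + J (z - p)`. Testing the hypothesis on `p` at `z` gives `-‖z - p‖² ≥
    -- 0`, hence `z = p`.
    obtain ⟨z, _, ⟨v, hv, rfl⟩, hz⟩ := exists_add_eq_of_strongly_monotone
      (C := fun z => (fun v => v + J (z - p)) '' B z) hm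
      (by
        rintro x y _ ⟨u, hu, rfl⟩ _ ⟨v, hv, rfl⟩
        have h1 := hB.1 x y u hu v hv
        have h2 := J_strongly_monotone hU (x - p) (y - p)
        rw [sub_sub_sub_cancel_right] at h2
        rw [add_sub_add_comm, add_apply]
        linarith)
      (fun g => hB.exists_add_J_eq hrefl hsing hne p g) hA hL 0
    have h1 := h z v hv
    rw [← add_assoc] at hz
    rw [eq_neg_of_add_eq_zero_left hz, neg_apply, J_self, Left.nonneg_neg_iff] at h1
    have h2 : z = p := by
      rw [← sub_eq_zero, ← norm_eq_zero, ← sq_eq_zero_iff]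
      exact le_antisymm h1 (sq_nonneg _)
    subst h2
    have h3 : J (z - z) = 0 := by rw [← norm_eq_zero, J_norm, sub_self, norm_zero]
    rw [h3, add_zero] at hz
    rw [mem_zeroSet_sumOperator, ← eq_neg_of_add_eq_zero_right hz]
    exact hv

end MaximalMonotone

/-! ### Generalized projections -/

section Projection

variable {E : Type*} [NormedAddCommGroup E] [NormedSpace ℝ E]

theorem phi_midpoint_add_le {m : ℝ}
    (hU : ∀ x y : E, ‖x‖ ^ 2 + m * ‖y‖ ^ 2 ≤ (‖x + y‖ ^ 2 + ‖x - y‖ ^ 2) / 2) (p q x : E) :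
    phi ((1 / 2 : ℝ) • p + (1 / 2 : ℝ) • q) x + m / 4 * ‖p - q‖ ^ 2 ≤ (phi p x + phi q x) / 2 := by
  have h1 := hU ((1 / 2 : ℝ) • p + (1 / 2 : ℝ) • q) ((1 / 2 : ℝ) • (p - q))
  have h2 : (1 / 2 : ℝ) • p + (1 / 2 : ℝ) • q + (1 / 2 : ℝ) • (p - q) = p := by module
  have h3 : (1 / 2 : ℝ) • p + (1 / 2 : ℝ) • q - (1 / 2 : ℝ) • (p - q) = q := by module
  rw [h2, h3, norm_smul, Real.norm_of_nonneg (by norm_num)] at h1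
  simp only [phi, map_add, map_smul, smul_eq_mul]
  linarith

/-- Generalized projections onto closed convex sets exist, and the minimum is strong. -/
theorem exists_strong_projection [CompleteSpace E] {m : ℝ} (hm : 0 < m)
    (hU : ∀ x y : E, ‖x‖ ^ 2 + m * ‖y‖ ^ 2 ≤ (‖x + y‖ ^ 2 + ‖x - y‖ ^ 2) / 2)
    {C : Set E} (hne : C.Nonempty) (hC : Convex ℝ C) (hcl : IsClosed C) (x : E) :
    ∃ p ∈ C, ∀ q ∈ C, phi p x + m / 2 * ‖p - q‖ ^ 2 ≤ phi q x := by
  have hnn : ∀ p, 0 ≤ phi p x := fun p =>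
    (by positivity : 0 ≤ m * ‖p - x‖ ^ 2).trans (mul_norm_sub_sq_le_phi hU p x)
  set d := sInf ((phi · x) '' C) with hd
  have hdle : ∀ p ∈ C, d ≤ phi p x := fun p hp =>
    csInf_le ⟨0, by rintro _ ⟨p, -, rfl⟩; exact hnn p⟩ ⟨p, hp, rfl⟩
  have hmid : ∀ p ∈ C, ∀ q ∈ C, d + m / 4 * ‖p - q‖ ^ 2 ≤ (phi p x + phi q x) / 2 :=
    fun p hp q hq => (add_le_add_left
      (hdle _ (hC hp hq (by norm_num) (by norm_num) (by norm_num))) _).trans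
      (phi_midpoint_add_le hU p q x)
  have hex : ∀ n : ℕ, ∃ p ∈ C, phi p x < d + 1 / ((n : ℝ) + 1) := fun n => by
    obtain ⟨_, ⟨p, hp, rfl⟩, h⟩ := exists_lt_of_csInf_lt (hne.image (phi · x))
      (lt_add_of_pos_right d (by positivity : 0 < 1 / ((n : ℝ) + 1)))
    exact ⟨p, hp, h⟩
  choose s hsC hs using hex
  have hcauchy : CauchySeq s := by
    rw [Metric.cauchySeq_iff]
    intro ε hε
    obtain ⟨N, hN⟩ := exists_nat_one_div_lt (by positivity : 0 < m / 4 * ε ^ 2)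
    have hle : ∀ n ≥ N, phi (s n) x < d + m / 4 * ε ^ 2 := fun n hn => by
      refine (hs n).trans_le ?_
      have : (N : ℝ) ≤ n := by exact_mod_cast hn
      have h1 : 1 / ((n : ℝ) + 1) ≤ 1 / ((N : ℝ) + 1) := by gcongr
      linarith
    refine ⟨N, fun i hi j hj => ?_⟩
    rw [dist_eq_norm]
    have h1 := hmid _ (hsC i) _ (hsC j)
    have h2 : m / 4 * ‖s i - s j‖ ^ 2 < m / 4 * ε ^ 2 := by linarith [hle i hi, hle j hj]
    exact lt_of_pow_lt_pow_left₀ 2 hε.le (lt_of_mul_lt_mul_left h2 (by positivity))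
  obtain ⟨p, hp⟩ := cauchySeq_tendsto_of_complete hcauchy
  have hpC : p ∈ C := hcl.mem_of_tendsto hp (Eventually.of_forall hsC)
  have hcont : Continuous fun p => phi p x := by unfold phi; fun_prop
  have hpd : phi p x ≤ d := by
    have h1 := tendsto_one_div_add_atTop_nhds_zero_nat (𝕜 := ℝ).const_add d
    rw [add_zero] at h1
    exact le_of_tendsto_of_tendsto' ((hcont.tendsto p).comp hp) h1 fun n => (hs n).le
  refine ⟨p, hpC, fun q hq => ?_⟩
  have h1 := hmid p hpC q hq
  have h2 := hdle p hpC
  linarith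

theorem IsGeneralizedProjection.eq_of_strong {m : ℝ} (hm : 0 < m) {C : Set E} {x p q : E}
    (hp : p ∈ C) (h : ∀ q ∈ C, phi p x + m / 2 * ‖p - q‖ ^ 2 ≤ phi q x)
    (hq : IsGeneralizedProjection C x q) : q = p := by
  have h1 := h q hq.1
  have h2 := hq.2 p hp
  have h3 : ‖p - q‖ ^ 2 ≤ 0 := by
    by_contra hlt
    push Not at hlt
    have := mul_pos hm hlt
    linarith
  have h4 := sq_eq_zero_iff.1 (le_antisymm h3 (sq_nonneg _))
  rw [norm_eq_zero, sub_eq_zero] at h4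
  exact h4.symm

/-- Projections of a `phi`-Fejér monotone sequence converge in norm. -/
theorem exists_tendsto_projection [CompleteSpace E] {m : ℝ} (hm : 0 < m)
    (hU : ∀ x y : E, ‖x‖ ^ 2 + m * ‖y‖ ^ 2 ≤ (‖x + y‖ ^ 2 + ‖x - y‖ ^ 2) / 2)
    {C : Set E} {x u : ℕ → E} (hfejer : ∀ p ∈ C, Antitone fun n => phi p (x n))
    (huC : ∀ n, u n ∈ C)
    (hu : ∀ n, ∀ q ∈ C, phi (u n) (x n) + m / 2 * ‖u n - q‖ ^ 2 ≤ phi q (x n)) :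
    ∃ z, Tendsto u atTop (𝓝 z) := by
  set d : ℕ → ℝ := fun n => phi (u n) (x n) with hd
  have hnn : ∀ n, 0 ≤ d n := fun n =>
    (by positivity : 0 ≤ m * ‖u n - x n‖ ^ 2).trans (mul_norm_sub_sq_le_phi hU _ _)
  -- Compare `u k` with the competitor `u n` at time `k`, then go back to time `n` by Fejér
  -- monotonicity.
  have hdist : ∀ n k, n ≤ k → d k + m / 2 * ‖u k - u n‖ ^ 2 ≤ d n := fun n k hnk =>
    (hu k _ (huC n)).trans (hfejer _ (huC n) hnk)
  have hanti : Antitone d := fun n k hnk =>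
    (le_add_of_nonneg_right (by positivity)).trans (hdist n k hnk)
  have hlim := tendsto_atTop_ciInf hanti ⟨0, by rintro _ ⟨n, rfl⟩; exact hnn n⟩
  set dinf := ⨅ n, d n with hdinf
  have hge : ∀ n, dinf ≤ d n := fun n => hanti.le_of_tendsto hlim n
  have hb : Tendsto (fun n => √(2 / m * (d n - dinf))) atTop (𝓝 0) := by
    have h1 := ((hlim.sub_const dinf).const_mul (2 / m)).sqrt
    rwa [sub_self, mul_zero, Real.sqrt_zero] at h1
  refine cauchySeq_tendsto_of_complete (cauchySeq_of_le_tendsto_0' _ (fun n k hnk => ?_) hb)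
  rw [dist_comm, dist_eq_norm]
  refine Real.le_sqrt_of_sq_le ?_
  have h1 := hdist n k hnk
  have h2 := hge k
  rw [div_mul_eq_mul_div, le_div_iff₀ hm]
  linarith

end Projection

/-! ### Descent, demiclosedness and cluster points -/

section Tseng

variable {E : Type*} [NormedAddCommGroup E] [NormedSpace ℝ E]

theorem isClosed_convex_zeroSet {A : E → StrongDual ℝ E} {B : E → Set (StrongDual ℝ E)}
    (h : ∀ p, p ∈ zeroSet (sumOperator A B) ↔ ∀ w, ∀ v ∈ B w, 0 ≤ (A w + v) (w - p)) :
    IsClosed (zeroSet (sumOperator A B)) ∧ Convex ℝ (zeroSet (sumOperator A B)) := by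
  have hset : zeroSet (sumOperator A B) =
      ⋂ (w : E) (v ∈ B w), {p | (A w + v) p ≤ (A w + v) w} := by
    ext p
    simp only [h, Set.mem_iInter, map_sub, sub_nonneg]
    rfl
  rw [hset]
  refine ⟨isClosed_iInter fun w => isClosed_iInter fun v => isClosed_iInter fun _ =>
    isClosed_le (by fun_prop) (by fun_prop), convex_iInter fun w => convex_iInter fun v =>
    convex_iInter fun _ => convex_halfSpace_le (A w + v).isLinear _⟩

/-- The graph of `A + B` is closed under weak convergence of the points together with norm
convergence of the values to `0`. -/
theorem mem_zeroSet_of_weaklyConverges {A : E → StrongDual ℝ E} {B : E → Set (StrongDual ℝ E)}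
    (hB : IsMonotoneOperator B) (hA : IsMonotoneMap A)
    (h : ∀ p, (∀ w, ∀ v ∈ B w, 0 ≤ (A w + v) (w - p)) → p ∈ zeroSet (sumOperator A B))
    {y : ℕ → E} {v : ℕ → StrongDual ℝ E} {R : ℝ} (hy : ∀ n, ‖y n‖ ≤ R) (hv : ∀ n, v n ∈ B (y n))
    (hlim : Tendsto (fun n => A (y n) + v n) atTop (𝓝 0)) {z : E} (hz : WeaklyConverges y z) :
    z ∈ zeroSet (sumOperator A B) := by
  refine h z fun w g hg => ?_
  have h1 : ∀ n, -(‖A (y n) + v n‖ * (‖w‖ + R)) ≤ (A w + g) (w - y n) := by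
    intro n
    have h2 := hA w (y n)
    have h3 := hB w (y n) g hg _ (hv n)
    have h4 : (A w + g) (w - y n) =
        (A w - A (y n)) (w - y n) + (g - v n) (w - y n) + (A (y n) + v n) (w - y n) := by
      simp only [add_apply, sub_apply]; ring
    have h5 := neg_le_of_abs_le ((A (y n) + v n).le_opNorm (w - y n))
    have h6 : ‖A (y n) + v n‖ * ‖w - y n‖ ≤ ‖A (y n) + v n‖ * (‖w‖ + R) := by
      gcongr
      exact (norm_sub_le _ _).trans (by linarith [hy n])
    linarith
  have h2 : Tendsto (fun n => -(‖A (y n) + v n‖ * (‖w‖ + R))) atTop (𝓝 0) := by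
    simpa using (hlim.norm.mul_const (‖w‖ + R)).neg
  have h3 : Tendsto (fun n => (A w + g) (w - y n)) atTop (𝓝 ((A w + g) (w - z))) := by
    simp only [map_sub]
    exact (weaklyConverges_iff.1 hz (A w + g)).const_sub _
  exact le_of_tendsto_of_tendsto' h2 h3 h1

/-- The basic descent estimate of Tseng's method. -/
theorem phi_tseng_step_le {A : E → StrongDual ℝ E} {B : E → Set (StrongDual ℝ E)}
    (hB : IsMonotoneOperator B) (hA : IsMonotoneMap A) {L : ℝ≥0} (hL : LipschitzWith L A) {κ : ℝ}
    (hκ : ∀ z : E, ∀ f ∈ dualitySet z, ∀ g : StrongDual ℝ E,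
      ‖f + g‖ ^ 2 ≤ ‖f‖ ^ 2 + 2 * g z + 2 * κ ^ 2 * ‖g‖ ^ 2)
    {p x y x' : E} (hp : p ∈ zeroSet (sumOperator A B)) {r : ℝ} (hr : 0 ≤ r)
    {v : StrongDual ℝ E} (hv : v ∈ B y) (hy : J x - r • A x = J y + r • v)
    (hx' : J x' = J y - r • (A y - A x)) :
    phi p x' + phi y x ≤ phi p x + 2 * κ ^ 2 * (r * (L * ‖y - x‖)) ^ 2 := by
  have h1 := hκ y (J y) (J_mem y) (-(r • (A y - A x)))
  rw [← sub_eq_add_neg, ← hx', J_norm, J_norm, norm_neg, norm_smul, Real.norm_of_nonneg hr] at h1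
  have h2 : ‖A y - A x‖ ≤ L * ‖y - x‖ := by
    rw [← dist_eq_norm, ← dist_eq_norm]; exact hL.dist_le_mul y x
  have h3 : 2 * κ ^ 2 * (r * ‖A y - A x‖) ^ 2 ≤ 2 * κ ^ 2 * (r * (L * ‖y - x‖)) ^ 2 := by gcongr
  have h4 := mul_nonneg hr (hB y p v hv _ (mem_zeroSet_sumOperator.1 hp))
  have h5 := mul_nonneg hr (hA y p)
  have h6 : J x = J y + r • v + r • A x := by rw [← hy]; abel
  -- After expansion the cross terms collect to `-2r (A y + v)(y - p)`, which `h4` and `h5` show to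
  -- be nonpositive.
  simp only [phi, hx', h6]
  rw [← J_self y] at *
  simp only [sub_apply, add_apply, smul_apply, neg_apply, smul_eq_mul, map_sub] at *
  linarith

theorem lt_inv_of_step_lt {μ κ L b : ℝ} (hμ : 0 < μ) (hκ : 0 < κ) (hL : 0 < L) (hb : 0 ≤ b)
    (h : b < 1 / (√(2 * μ) * κ * L)) : 2 * κ ^ 2 * (b * L) ^ 2 < μ⁻¹ := by
  rw [lt_div_iff₀ (by positivity)] at h
  have h1 : (b * (√(2 * μ) * κ * L)) ^ 2 < 1 := by
    rw [sq_lt_one_iff₀ (by positivity)]; exact h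
  rw [mul_pow, mul_pow, mul_pow, Real.sq_sqrt (by positivity)] at h1
  rw [← one_div, lt_div_iff₀ hμ]
  linarith

/-- A weak cluster point of `x` in `C` coincides with the norm limit of the projections onto `C`. -/
theorem eq_of_weak_cluster {m : ℝ} (hm : 0 < m)
    (hU : ∀ x y : E, ‖x‖ ^ 2 + m * ‖y‖ ^ 2 ≤ (‖x + y‖ ^ 2 + ‖x - y‖ ^ 2) / 2)
    (hJ : DualityWeaklySeqContinuous E) {x u : ℕ → E} {z q : E} {R : ℝ} (hx : ∀ n, ‖x n‖ ≤ R)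
    (hz : WeaklyConverges x z) (hu : Tendsto u atTop (𝓝 q))
    (hle : ∀ n, phi (u n) (x n) ≤ phi z (x n)) : z = q := by
  have hJz := weakStarConverges_iff.1 (hJ x z hz)
  have h1 : Tendsto (fun n => J (x n) (u n)) atTop (𝓝 (J z q)) := by
    have h2 : Tendsto (fun n => J (x n) (u n - q)) atTop (𝓝 0) := by
      refine squeeze_zero_norm (a := fun n => R * ‖u n - q‖) (fun n => ?_) ?_
      · refine ((J (x n)).le_opNorm _).trans ?_
        rw [J_norm]
        gcongr
        exact hx n
      · simpa using (hu.sub_const q).norm.const_mul R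
    simpa using h2.add (hJz q)
  -- The term `‖x n‖²`, not weakly continuous, cancels from both sides of `hle`. The limit says
  -- `φ(q, z) ≤ 0`.
  have h2 : ‖q‖ ^ 2 - 2 * J z q ≤ ‖z‖ ^ 2 - 2 * J z z := by
    refine le_of_tendsto_of_tendsto' ((hu.norm.pow 2).sub (h1.const_mul 2))
      (((hJz z).const_mul 2).const_sub (‖z‖ ^ 2)) fun n => ?_
    have := hle n
    simp only [phi] at this
    linarith
  have h3 := mul_norm_sub_sq_le_phi hU q z
  rw [J_self] at h2
  simp only [phi] at h3
  have h4 : ‖q - z‖ ^ 2 ≤ 0 := by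
    by_contra hlt
    push Not at hlt
    have := mul_pos hm hlt
    linarith
  have h5 := sq_eq_zero_iff.1 (le_antisymm h4 (sq_nonneg _))
  rw [norm_eq_zero, sub_eq_zero] at h5
  exact h5.symm

end Tseng

end BanachTseng

/-! ### Convergence of the iteration -/

theorem mainTheorem1 {E : Type*} [NormedAddCommGroup E] [NormedSpace ℝ E] [CompleteSpace E]
    (hconv : BanachTseng.IsTwoUniformlyConvex E)
    (hsmooth : BanachTseng.IsUniformlySmooth E)
    (hJ : BanachTseng.DualityWeaklySeqContinuous E)
    (A : E → StrongDual ℝ E) (B : E → Set (StrongDual ℝ E)) (L : ℝ≥0)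
    (hB : BanachTseng.IsMaximalMonotone B)
    (hA : BanachTseng.IsMonotoneMap A)
    (hL : 0 < L) (hAL : LipschitzWith L A)
    (hsol : (BanachTseng.zeroSet (BanachTseng.sumOperator A B)).Nonempty)
    (lam : ℕ → ℝ) (a b : ℝ) (ha : 0 < a) (hlam : ∀ n, a ≤ lam n ∧ lam n ≤ b)
    (hb : b < 1 / (√(2 * BanachTseng.twoUniformConvexityConst E) *
      BanachTseng.twoUniformSmoothnessConst (StrongDual ℝ E) * (L : ℝ)))
    (x y : ℕ → E) (hxy : BanachTseng.IsTsengSequence A B lam x y) :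
    (∀ n, ∃! p, BanachTseng.IsGeneralizedProjection
      (BanachTseng.zeroSet (BanachTseng.sumOperator A B)) (x n) p) ∧
    ∃ z ∈ BanachTseng.zeroSet (BanachTseng.sumOperator A B),
      BanachTseng.WeaklyConverges x z ∧
      ∀ u : ℕ → E,
        (∀ n, BanachTseng.IsGeneralizedProjection
          (BanachTseng.zeroSet (BanachTseng.sumOperator A B)) (x n) (u n)) →
        Tendsto u atTop (𝓝 z) := by
  set μ := BanachTseng.twoUniformConvexityConst E with hμ
  set κ := BanachTseng.twoUniformSmoothnessConst (StrongDual ℝ E) with hκ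
  set C := BanachTseng.zeroSet (BanachTseng.sumOperator A B) with hCdef
  obtain ⟨hμ1, hU⟩ := BanachTseng.twoUniformConvexityConst_spec hconv
  rw [← hμ] at hμ1 hU
  have hμ0 : 0 < μ := by linarith
  have hm : 0 < μ⁻¹ := inv_pos.2 hμ0
  have hrefl := BanachTseng.inclusionInDoubleDual_surjective hm hU
  obtain ⟨hκ1, hS⟩ := BanachTseng.twoUniformSmoothnessConst_dual_spec hm hU hrefl
  rw [← hκ] at hκ1 hS
  have hκ0 : 0 < κ := lt_of_lt_of_le (by positivity) hκ1
  have hlam0 : ∀ n, 0 < lam n := fun n => ha.trans_le (hlam n).1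
  have hb0 : 0 < b := (hlam0 0).trans_le (hlam 0).2
  obtain ⟨p₀, hp₀⟩ := hsol
  have hne : ∃ w, (B w).Nonempty := ⟨p₀, _, BanachTseng.mem_zeroSet_sumOperator.1 hp₀⟩
  have hmem : ∀ p, p ∈ C ↔ ∀ w, ∀ v ∈ B w, 0 ≤ (A w + v) (w - p) := fun p =>
    BanachTseng.mem_zeroSet_iff_forall hm hU (fun _ _ hf => hsmooth.eq_J hf) hB hA hAL hne
  obtain ⟨hCcl, hCconv⟩ := BanachTseng.isClosed_convex_zeroSet hmem
  have hproj := fun n =>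
    BanachTseng.exists_strong_projection hm hU ⟨p₀, hp₀⟩ hCconv hCcl (x n)
  choose u huC hu using hproj
  have hproj_eq : ∀ n p, BanachTseng.IsGeneralizedProjection C (x n) p → p = u n := fun n p hp =>
    hp.eq_of_strong hm (huC n) (hu n)
  have hu_le : ∀ n, ∀ q ∈ C, BanachTseng.phi (u n) (x n) ≤ BanachTseng.phi q (x n) :=
    fun n q hq => (le_add_of_nonneg_right (by positivity)).trans (hu n q hq)
  refine ⟨fun n => ⟨u n, ⟨huC n, hu_le n⟩, hproj_eq n⟩, ?_⟩
  have hres : ∀ n, ∃ v ∈ B (y n),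
      BanachTseng.J (x n) - lam n • A (x n) = BanachTseng.J (y n) + lam n • v := fun n => by
    obtain ⟨⟨w, hw, v, hv, hwv⟩, -⟩ := hxy n
    exact ⟨v, hv, by rw [← hw, hwv]⟩
  choose v hvB hv using hres
  set c := μ⁻¹ - 2 * κ ^ 2 * (b * L) ^ 2 with hc
  have hc0 : 0 < c :=
    sub_pos.2 (BanachTseng.lt_inv_of_step_lt hμ0 hκ0 (by exact_mod_cast hL) hb0.le hb)
  have hdesc : ∀ p ∈ C, ∀ n, BanachTseng.phi p (x (n + 1)) + c * ‖y n - x n‖ ^ 2 ≤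
      BanachTseng.phi p (x n) := by
    intro p hp n
    have h1 := BanachTseng.phi_tseng_step_le hB.1 hA hAL hS hp (hlam0 n).le (hvB n) (hv n)
      (hxy n).2
    have h2 := BanachTseng.mul_norm_sub_sq_le_phi hU (y n) (x n)
    have h3 : 2 * κ ^ 2 * (lam n * (L * ‖y n - x n‖)) ^ 2 ≤
        2 * κ ^ 2 * (b * (L * ‖y n - x n‖)) ^ 2 := by
      have := (hlam0 n).le
      gcongr
      exact (hlam n).2
    rw [hc]
    nlinarith
  have hfejer : ∀ p ∈ C, Antitone fun n => BanachTseng.phi p (x n) := fun p hp =>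
    antitone_nat_of_succ_le fun n =>
      (le_add_of_nonneg_right (by positivity)).trans (hdesc p hp n)
  have hphi0 : ∀ p n, 0 ≤ BanachTseng.phi p (x n) := fun p n =>
    (by positivity : 0 ≤ μ⁻¹ * ‖p - x n‖ ^ 2).trans (BanachTseng.mul_norm_sub_sq_le_phi hU _ _)
  have hyx : Tendsto (fun n => ‖y n - x n‖) atTop (𝓝 0) := by
    have h1 := tendsto_atTop_ciInf (hfejer p₀ hp₀) ⟨0, by rintro _ ⟨n, rfl⟩; exact hphi0 p₀ n⟩
    have h2 := ((h1.sub (h1.comp (tendsto_add_atTop_nat 1))).const_mul c⁻¹).sqrt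
    rw [sub_self, mul_zero, Real.sqrt_zero] at h2
    refine squeeze_zero (fun n => norm_nonneg _) (fun n => Real.le_sqrt_of_sq_le ?_) h2
    rw [le_inv_mul_iff₀ hc0]
    simp only [Function.comp_apply]
    linarith [hdesc p₀ hp₀ n]
  have hyx' : Tendsto (fun n => y n - x n) atTop (𝓝 0) := tendsto_zero_iff_norm_tendsto_zero.2 hyx
  obtain ⟨R, hxR⟩ : ∃ R, ∀ n, ‖x n‖ ≤ R := by
    refine ⟨‖p₀‖ + √(μ * BanachTseng.phi p₀ (x 0)), fun n => ?_⟩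
    have h1 := (BanachTseng.mul_norm_sub_sq_le_phi hU p₀ (x n)).trans (hfejer p₀ hp₀ n.zero_le)
    rw [inv_mul_le_iff₀ hμ0] at h1
    have h2 := Real.le_sqrt_of_sq_le h1
    have h3 : ‖x n‖ ≤ ‖p₀‖ + ‖p₀ - x n‖ := by
      simpa using norm_sub_le p₀ (p₀ - x n)
    linarith
  obtain ⟨D, hD⟩ := hyx.bddAbove_range
  have hyR : ∀ n, ‖y n‖ ≤ R + D := fun n => by
    have h1 : ‖y n‖ ≤ ‖x n‖ + ‖y n - x n‖ := by simpa using norm_add_le (x n) (y n - x n)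
    have h2 : ‖y n - x n‖ ≤ D := hD ⟨n, rfl⟩
    linarith [hxR n]
  -- The residual equals `(A y_n - A x_n) + λ_n⁻¹ (J x_n - J y_n)`; the lower bound `a` on the steps
  -- controls `λ_n⁻¹`.
  have hresid : Tendsto (fun n => A (y n) + v n) atTop (𝓝 0) := by
    have h1 : Tendsto (fun n => BanachTseng.J (x n) - BanachTseng.J (y n)) atTop (𝓝 0) :=
      hsmooth.tendsto_J_sub_J hxR (by simpa using hyx'.neg)
    refine squeeze_zero_norm (a := fun n =>
      L * ‖y n - x n‖ + a⁻¹ * ‖BanachTseng.J (x n) - BanachTseng.J (y n)‖) (fun n => ?_)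
      (by simpa using (hyx.const_mul (L : ℝ)).add (h1.norm.const_mul a⁻¹))
    have h2 : A (y n) + v n = (A (y n) - A (x n)) +
        (lam n)⁻¹ • (BanachTseng.J (x n) - BanachTseng.J (y n)) := by
      have h3 : BanachTseng.J (x n) - BanachTseng.J (y n) = lam n • (A (x n) + v n) := by
        rw [smul_add, sub_eq_iff_eq_add, add_assoc, add_comm _ (BanachTseng.J (y n)), ← hv n]
        abel
      rw [h3, smul_smul, inv_mul_cancel₀ (hlam0 n).ne', one_smul]
      abel
    rw [h2]
    refine (norm_add_le _ _).trans (add_le_add ?_ ?_)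
    · rw [← dist_eq_norm, ← dist_eq_norm]
      exact hAL.dist_le_mul _ _
    · rw [norm_smul, norm_inv, Real.norm_of_nonneg (hlam0 n).le]
      gcongr
      exact (hlam n).1
  obtain ⟨q, hq⟩ := BanachTseng.exists_tendsto_projection hm hU hfejer huC hu
  refine ⟨q, hCcl.mem_of_tendsto hq (Eventually.of_forall huC), ?_, fun u' hu' => ?_⟩
  -- It suffices that every subsequence has a further one converging weakly to `q`.
  · refine tendsto_of_subseq_tendsto fun ns hns => ?_
    obtain ⟨z, φ, hφ, hz⟩ := BanachTseng.exists_weaklyConverges_subseq hrefl hsmooth.continuous_J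
      (x := fun k => x (ns k)) (fun k => hxR (ns k))
    have hψ : Tendsto (fun k => ns (φ k)) atTop atTop := hns.comp hφ.tendsto_atTop
    have hzy : BanachTseng.WeaklyConverges (fun k => y (ns (φ k))) z := by
      rw [BanachTseng.weaklyConverges_iff] at hz ⊢
      intro f
      have h1 := (hz f).add ((f.continuous.tendsto 0).comp (hyx'.comp hψ))
      simpa using h1
    have hzC : z ∈ C := BanachTseng.mem_zeroSet_of_weaklyConverges hB.1 hA
      (fun p hp => (hmem p).2 hp) (fun k => hyR _) (fun k => hvB _) (hresid.comp hψ) hzy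
    have hzq : z = q := BanachTseng.eq_of_weak_cluster hm hU hJ (fun k => hxR (ns (φ k))) hz
      (hq.comp hψ) fun k => hu_le _ z hzC
    exact ⟨φ, hzq ▸ hz⟩
  · have : u' = u := funext fun n => hproj_eq n _ (hu' n)
    rwa [this]
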